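/- Let $n\ge 0$ and let $F\in\mathbb C\{x_0,\dots,x_n,t\}$ be a convergent power series such that $f(x):=F(x,0)\in\mathbb C\{x_0,\dots,x_n\}$ satisfies $f\neq 0$ and $f(0)=0$. Put $R:=\mathbb C\{x_0,\dots,x_n,t\}/(F)$, a $\mathbb C\{t\}$-algebra, and $\overline R:=\mathbb C\{x_0,\dots,x_n\}/(f)=R/tR$. Let $M,N$ be finitely generated $R$-modules that are flat over $\mathbb C\{t\}$, and let $\overline M:=\overline R\otimes_R M=M/tM$ and $\overline N:=\overline R\otimes_R N=N/tN$ be the corresponding $\overline R$-modules. Assume that $f$ defines an isolated hypersurface singularity, that is, $\dim_{\mathbb C}\mathbb C\{x_0,\dots,x_n\}/(\partial f/\partial x_0,\dots,\partial f/\partial x_n)<\infty$, or, more generally, that $\mathrm{Tor}^{\overline R}_i(\overline M,\overline N)$ has finite length for all sufficiently large $i$. Then, for $k\gg 0$, the lengths of $\mathrm{Tor}^{\overline R}_{2k}(\overline M,\overline N)$ and $\mathrm{Tor}^{\overline R}_{2k+1}(\overline M,\overline N)$ are finite and independent of $k$, so that Hochster's Theta pairing $$\theta(\overline M,\overline N):=\mathrm{length}\,\mathrm{Tor}^{\overline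 R}_{2k}(\overline M,\overline N)-\mathrm{length}\,\mathrm{Tor}^{\overline R}_{2k+1}(\overline M,\overline N)\qquad(k\gg 0)$$ is defined; the modules $\mathrm{Tor}^R_{2k}(M,N)$ and $\mathrm{Tor}^R_{2k+1}(M,N)$ are, for $k\gg0$, finitely generated over $\mathbb C\{t\}$, of ranks independent of $k$; and, for $k\gg0$, $$\theta(\overline M,\overline N)=\mathrm{Rank}_{\mathbb C\{t\}}\mathrm{Tor}^R_{2k}(M,N)-\mathrm{Rank}_{\mathbb C\{t\}}\mathrm{Tor}^R_{2k+1}(M,N).$$ -/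

import Mathlib

open Filter CategoryTheory
open scoped TensorProduct

universe u

noncomputable section

/-! ## Rings of convergent power series -/

/-- A complex power series converges (near the origin) if it converges absolutely at the point
`(r, …, r)` for some `r > 0`. -/
def IsConvergent {σ : Type*} (f : MvPowerSeries σ ℂ) : Prop :=
  ∃ r : ℝ, 0 < r ∧ Summable fun d : σ →₀ ℕ => ‖MvPowerSeries.coeff d f‖ * r ^ d.degree

namespace IsConvergent

variable {σ τ : Type*}

lemma summable_of_le {f : MvPowerSeries σ ℂ} {r s : ℝ} (hs : 0 ≤ s) (hsr : s ≤ r)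
    (h : Summable fun d : σ →₀ ℕ => ‖MvPowerSeries.coeff d f‖ * r ^ d.degree) :
    Summable fun d : σ →₀ ℕ => ‖MvPowerSeries.coeff d f‖ * s ^ d.degree :=
  Summable.of_nonneg_of_le (fun d => by positivity) (fun d => by gcongr) h

lemma const (c : ℂ) : IsConvergent (algebraMap ℂ (MvPowerSeries σ ℂ) c) := by
  classical
  refine ⟨1, one_pos, summable_of_ne_finset_zero (s := {0}) fun d hd => ?_⟩
  have hd' : d ≠ 0 := by simpa using hd
  simp [MvPowerSeries.algebraMap_apply, MvPowerSeries.coeff_C, hd']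

lemma add {f g : MvPowerSeries σ ℂ} (hf : IsConvergent f) (hg : IsConvergent g) :
    IsConvergent (f + g) := by
  obtain ⟨r, hr, hf⟩ := hf
  obtain ⟨s, hs, hg⟩ := hg
  have hm : 0 < min r s := lt_min hr hs
  refine ⟨min r s, hm, Summable.of_nonneg_of_le (fun d => by positivity) (fun d => ?_)
    ((summable_of_le hm.le (min_le_left r s) hf).add
      (summable_of_le hm.le (min_le_right r s) hg))⟩
  rw [← add_mul, map_add]
  gcongr
  exact norm_add_le _ _

lemma summable_antidiagonal [DecidableEq σ] {u v : (σ →₀ ℕ) → ℝ} (hu0 : ∀ d, 0 ≤ u d)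
    (hv0 : ∀ d, 0 ≤ v d) (hu : Summable u) (hv : Summable v) :
    Summable fun d => ∑ p ∈ Finset.HasAntidiagonal.antidiagonal d, u p.1 * v p.2 := by
  have h : Summable fun x : (σ →₀ ℕ) × (σ →₀ ℕ) => u x.1 * v x.2 := hu.mul_of_nonneg hv hu0 hv0
  exact summable_sum_mul_antidiagonal_of_summable_mul h

lemma mul {f g : MvPowerSeries σ ℂ} (hf : IsConvergent f) (hg : IsConvergent g) :
    IsConvergent (f * g) := by
  classical
  obtain ⟨r, hr, hf⟩ := hf
  obtain ⟨s, hs, hg⟩ := hg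
  have hm : 0 < min r s := lt_min hr hs
  have hf' := summable_of_le hm.le (min_le_left r s) hf
  have hg' := summable_of_le hm.le (min_le_right r s) hg
  have key := summable_antidiagonal (fun d => by positivity) (fun d => by positivity) hf' hg'
  refine ⟨min r s, hm, Summable.of_nonneg_of_le (fun d => by positivity) (fun d => ?_) key⟩
  have h1 : ‖MvPowerSeries.coeff d (f * g)‖ ≤ ∑ p ∈ Finset.HasAntidiagonal.antidiagonal d,
      ‖MvPowerSeries.coeff p.1 f‖ * ‖MvPowerSeries.coeff p.2 g‖ := by
    rw [MvPowerSeries.coeff_mul]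
    exact (norm_sum_le _ _).trans (Finset.sum_le_sum fun p _ => norm_mul_le _ _)
  refine (mul_le_mul_of_nonneg_right h1 (by positivity)).trans (le_of_eq ?_)
  rw [Finset.sum_mul]
  refine Finset.sum_congr rfl fun p hp => ?_
  have h2 : d.degree = p.1.degree + p.2.degree := by
    rw [← Finset.HasAntidiagonal.mem_antidiagonal.mp hp, map_add]
  rw [h2, pow_add]
  ring

lemma degree_embDomain (e : σ ↪ τ) (d : σ →₀ ℕ) :
    (Finsupp.embDomain e d).degree = d.degree := by
  simp [Finsupp.degree_apply, Finsupp.support_embDomain]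

lemma rename {f : MvPowerSeries σ ℂ} (hf : IsConvergent f) (e : σ ↪ τ) :
    IsConvergent (MvPowerSeries.rename e f) := by
  obtain ⟨r, hr, hf⟩ := hf
  refine ⟨r, hr, ?_⟩
  rw [← (Finsupp.embDomain_injective e).summable_iff]
  · refine hf.congr fun d => ?_
    simp [MvPowerSeries.coeff_embDomain_rename, degree_embDomain]
  · intro d hd
    rw [MvPowerSeries.coeff_rename_eq_zero, norm_zero, zero_mul]
    rintro ⟨x, hx⟩
    exact hd ⟨x, by rw [← hx, Finsupp.embDomain_eq_mapDomain]⟩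

lemma killCompl {f : MvPowerSeries τ ℂ} (hf : IsConvergent f) (e : σ ↪ τ) :
    IsConvergent (MvPowerSeries.killCompl e f) := by
  obtain ⟨r, hr, hf⟩ := hf
  refine ⟨r, hr, (hf.comp_injective (Finsupp.embDomain_injective e)).congr fun d => ?_⟩
  simp [MvPowerSeries.coeff_killCompl, degree_embDomain]

lemma pderiv {f : MvPowerSeries σ ℂ} (hf : IsConvergent f) (i : σ) :
    IsConvergent (MvPowerSeries.pderiv ℂ i f) := by
  classical
  obtain ⟨r, hr, hf⟩ := hf
  refine ⟨r / 2, by positivity, Summable.of_nonneg_of_le (fun d => by positivity) (fun d => ?_)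
    ((hf.comp_injective (add_left_injective (Finsupp.single i 1))).mul_left r⁻¹)⟩
  have h1 : ((d i : ℝ) + 1) ≤ 2 ^ d.degree := by
    have h : d i + 1 ≤ 2 ^ d.degree :=
      (Nat.succ_le_succ (Finsupp.le_degree i d)).trans Nat.lt_two_pow_self
    exact_mod_cast h
  have h2 : ‖(d i : ℂ) + 1‖ = (d i : ℝ) + 1 := by
    have : ((d i : ℂ) + 1) = ((d i + 1 : ℕ) : ℂ) := by push_cast; rfl
    rw [this, Complex.norm_natCast]; push_cast; rfl
  rw [MvPowerSeries.coeff_pderiv, norm_mul, h2, div_pow]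
  simp only [Function.comp, map_add, Finsupp.degree_single, pow_add, pow_one]
  have h3 : ((d i : ℝ) + 1) * (r ^ d.degree / 2 ^ d.degree) ≤ r ^ d.degree := by
    rw [mul_div_assoc', div_le_iff₀ (by positivity), mul_comm]
    gcongr
  calc _ = ‖MvPowerSeries.coeff (d + Finsupp.single i 1) f‖ *
        (((d i : ℝ) + 1) * (r ^ d.degree / 2 ^ d.degree)) := by ring
    _ ≤ ‖MvPowerSeries.coeff (d + Finsupp.single i 1) f‖ * r ^ d.degree := by gcongr
    _ = _ := by field_simp

end IsConvergent

/-- The subalgebra of convergent power series in the algebra of formal power series. -/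
def convergentSubalgebra (σ : Type*) : Subalgebra ℂ (MvPowerSeries σ ℂ) where
  carrier := {f | IsConvergent f}
  mul_mem' hf hg := IsConvergent.mul hf hg
  add_mem' hf hg := IsConvergent.add hf hg
  algebraMap_mem' c := IsConvergent.const c

/-- The ring `ℂ{x_i : i ∈ σ}` of convergent power series in (finitely many) variables `x_i`. -/
def ConvPS (σ : Type*) : Type _ := convergentSubalgebra σ

instance (σ : Type*) : CommRing (ConvPS σ) := inferInstanceAs (CommRing (convergentSubalgebra σ))

instance (σ : Type*) : Algebra ℂ (ConvPS σ) :=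
  inferInstanceAs (Algebra ℂ (convergentSubalgebra σ))

namespace ConvPS

variable {σ : Type*}

/-- The inclusion of convergent power series into formal power series. -/
def toFormal (σ : Type*) : ConvPS σ →ₐ[ℂ] MvPowerSeries σ ℂ := (convergentSubalgebra σ).val

lemma isConvergent (f : ConvPS σ) : IsConvergent (toFormal σ f) := f.2

/-- A convergent power series from a formal one. -/
def ofFormal (f : MvPowerSeries σ ℂ) (hf : IsConvergent f) : ConvPS σ := ⟨f, hf⟩

/-- A homomorphism of formal power series rings that preserves convergence restricts to the rings
of convergent power series. -/
def restrictHom {τ : Type*} (φ : MvPowerSeries σ ℂ →ₐ[ℂ] MvPowerSeries τ ℂ)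
    (h : ∀ f, IsConvergent f → IsConvergent (φ f)) : ConvPS σ →ₐ[ℂ] ConvPS τ :=
  (φ.comp (convergentSubalgebra σ).val).codRestrict (convergentSubalgebra τ) fun f => h _ f.2

/-- The value `f(0)`. -/
def constantCoeff (f : ConvPS σ) : ℂ := MvPowerSeries.constantCoeff (toFormal σ f)

/-- The partial derivative `∂f/∂x_i`. -/
def pderiv (i : σ) (f : ConvPS σ) : ConvPS σ :=
  ofFormal (MvPowerSeries.pderiv ℂ i (toFormal σ f)) (f.isConvergent.pderiv i)

end ConvPS

/-- The Jacobian ideal `(∂f/∂x_i : i)` of `ℂ{x_i : i ∈ σ}`. -/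
def jacobianIdeal {σ : Type*} (f : ConvPS σ) : Ideal (ConvPS σ) :=
  Ideal.span (Set.range fun i : σ => f.pderiv i)

/-- `f` has at most an isolated singularity at the origin: `f(0) = 0` and the Milnor number
`μ(f) = dim_ℂ ℂ{x} / (∂f/∂x_i : i)` is finite. -/
def IsIsolatedSingularity {σ : Type*} (f : ConvPS σ) : Prop :=
  f.constantCoeff = 0 ∧ Module.Finite ℂ (ConvPS σ ⧸ jacobianIdeal f)

/-- The hypersurface ring `ℂ{x_i : i ∈ σ} / (g)`. -/
def HypersurfaceRing {σ : Type*} (g : ConvPS σ) : Type _ :=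
  ConvPS σ ⧸ Ideal.span {g}

instance {σ : Type*} (g : ConvPS σ) : CommRing (HypersurfaceRing g) :=
  inferInstanceAs (CommRing (ConvPS σ ⧸ Ideal.span {g}))

/-! ## One-parameter deformations

The variables of `ℂ{x, t}` are indexed by `ι ⊕ Unit`, with `Sum.inl i` the index of `x_i` and
`Sum.inr ()` the index of the parameter `t`. -/

/-- The inclusion `ℂ{t} → ℂ{x, t}`. -/
def parameterInclusion (ι : Type*) : ConvPS Unit →ₐ[ℂ] ConvPS (ι ⊕ Unit) :=
  ConvPS.restrictHom (MvPowerSeries.rename (Function.Embedding.inr : Unit ↪ ι ⊕ Unit))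
    fun _ h => h.rename _

/-- The substitution `t = 0`, as a ring homomorphism `ℂ{x, t} → ℂ{x}`, `F ↦ F(x, 0)`. -/
def atZero (ι : Type*) : ConvPS (ι ⊕ Unit) →ₐ[ℂ] ConvPS ι :=
  ConvPS.restrictHom (MvPowerSeries.killCompl (Function.Embedding.inl : ι ↪ ι ⊕ Unit))
    fun _ h => h.killCompl _

/-- `ℂ{x, t} / (F)` is an algebra over `ℂ{t}`. -/
instance parameterAlgebra {ι : Type*} (F : ConvPS (ι ⊕ Unit)) :
    Algebra (ConvPS Unit) (HypersurfaceRing F) :=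
  ((Ideal.Quotient.mk (Ideal.span {F})).comp (parameterInclusion ι).toRingHom :
    ConvPS Unit →+* HypersurfaceRing F).toAlgebra

/-- The ring homomorphism `ℂ{x, t} / (F) → ℂ{x} / (F(x, 0))` induced by `t = 0`. -/
def toSpecialFibre {ι : Type*} (F : ConvPS (ι ⊕ Unit)) :
    HypersurfaceRing F →+* HypersurfaceRing (atZero ι F) :=
  Ideal.quotientMap (Ideal.span {atZero ι F}) (atZero ι).toRingHom (by
    rw [Ideal.span_singleton_le_iff_mem, Ideal.mem_comap]
    exact Ideal.mem_span_singleton_self _)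

instance specialFibreAlgebra {ι : Type*} (F : ConvPS (ι ⊕ Unit)) :
    Algebra (HypersurfaceRing F) (HypersurfaceRing (atZero ι F)) :=
  (toSpecialFibre F).toAlgebra

/-- The reduction `M̄ = R̄ ⊗_R M = M / tM` of a module over `R = ℂ{x, t} / (F)`, as a module over
`R̄ = ℂ{x} / (F(x, 0)) = R / tR`. -/
abbrev SpecialFibre {ι : Type*} (F : ConvPS (ι ⊕ Unit)) (M : Type*) [AddCommGroup M]
    [Module (HypersurfaceRing F) M] : Type _ :=
  HypersurfaceRing (atZero ι F) ⊗[HypersurfaceRing F] M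

/-! ## Tor and Hochster's Theta pairing -/

/-- The `R`-module `Tor_i^R(M, N)`. -/
abbrev torModule (R : Type u) [CommRing R] (M N : Type u) [AddCommGroup M] [Module R M]
    [AddCommGroup N] [Module R N] (i : ℕ) : ModuleCat R :=
  ((Tor (ModuleCat R) i).obj (ModuleCat.of R M)).obj (ModuleCat.of R N)

/-- `Tor_i^R(M, N)`, regarded as a module over `A` for an `A`-algebra `R`. -/
abbrev torModuleOver (A R : Type u) [CommRing A] [CommRing R] [Algebra A R] (M N : Type u)
    [AddCommGroup M] [Module R M] [AddCommGroup N] [Module R N] (i : ℕ) : ModuleCat A :=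
  (ModuleCat.restrictScalars (algebraMap A R)).obj (torModule R M N i)

/-- `HasTheta R M N θ`: Hochster's Theta pairing `θ(M, N)` over `R` is defined, with value `θ`.
That is, for `k ≫ 0` the modules `Tor_{2k}^R(M, N)` and `Tor_{2k+1}^R(M, N)` have finite lengths
independent of `k`, and `θ` is the difference of these lengths. -/
def HasTheta (R : Type u) [CommRing R] (M N : Type u) [AddCommGroup M] [Module R M]
    [AddCommGroup N] [Module R N] (θ : ℤ) : Prop :=
  ∃ a b : ℕ, (∀ᶠ k : ℕ in atTop, Module.length R (torModule R M N (2 * k)) = a) ∧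
    (∀ᶠ k : ℕ in atTop, Module.length R (torModule R M N (2 * k + 1)) = b) ∧
    θ = (a : ℤ) - (b : ℤ)

lemma HasTheta.unique {R : Type u} [CommRing R] {M N : Type u} [AddCommGroup M] [Module R M]
    [AddCommGroup N] [Module R N] {θ θ' : ℤ} (h : HasTheta R M N θ) (h' : HasTheta R M N θ') :
    θ = θ' := by
  obtain ⟨a, b, ha, hb, rfl⟩ := h
  obtain ⟨a', b', ha', hb', rfl⟩ := h'
  obtain ⟨k, h1, h2, h3, h4⟩ := (ha.and (hb.and (ha'.and hb'))).exists
  have e1 : a = a' := by exact_mod_cast h1.symm.trans h3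
  have e2 : b = b' := by exact_mod_cast h2.symm.trans h4
  rw [e1, e2]

end

/-! Write `S = ℂ{x, t}` and `R = S / (F)`, and let primes denote reduction at `t = 0`. The ring `S`
is a Noetherian local domain of finite global dimension. Since `R` has projective dimension one over
`S`, passing to `R`-syzygies of `N` lowers the projective dimension over `S` until it is at most
one. Such a module is the cokernel of a square matrix `A` that belongs to a matrix factorization `A
B = B A = F` (Eisenbud). Hence `Tor^R_i(M, N)` is, for large `i`, alternately the homology `H(A, B)
= ker A / im B` and `H(B, A)` of the two-periodic complex on `M^m` (`torModule_matrix`). Flatness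
makes `t` a nonzerodivisor on `M` and `N`, so syzygies of `N` reduce to syzygies of `N'`, and the
same matrices at `t = 0` compute the Tor of `M'` and `N'` (`exists_isTorTail`). Multiplication by
`t` on the two-periodic complex then gives short exact sequences `0 → H(A, B)/t → H'(A, B) → H(B,
A)[t] → 0`, where `[t]` is the kernel of `t` (`length_matHomology_fibre`). If the fibre homology
`H'` has finite length, Weierstrass finiteness makes `H(A, B)` and `H(B, A)` finite over the
discrete valuation ring `ℂ{t}`. There `length (T/tT) - length T[t] = rank T`
(`length_smulCoker_eq`). In the difference of the two lengths of `H'` the torsion terms cancel, and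
the difference of the ranks remains. For an isolated singularity `H'` has finite length because
differentiating `B A = f` shows that every `∂f/∂x_i` kills it. The required facts on convergent
power series (units, Noetherianity, the uniformizer of `ℂ{t}`, the quotient by a variable,
Weierstrass finiteness) all follow from one division theorem, `ConvPS.exists_division`. -/

noncomputable section

/-! ### Splicing resolutions and dimension shifting for derived functors -/

namespace CategoryTheory.ProjectiveResolution

open CategoryTheory.Limits

variable {C : Type*} [Category* C] [Abelian C] {K P N : C}

/-- The augmentation `Q₀ ⟶ K` of a projective resolution of `K`. -/
def augmentation (Q : ProjectiveResolution K) : Q.complex.X 0 ⟶ K := Q.π.f 0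

lemma d_comp_augmentation (Q : ProjectiveResolution K) :
    Q.complex.d 1 0 ≫ Q.augmentation = 0 := Q.complex_d_comp_π_f_zero

lemma exact_augmentation (Q : ProjectiveResolution K) :
    (ShortComplex.mk _ _ Q.d_comp_augmentation).Exact := Q.exact₀

instance (Q : ProjectiveResolution K) : Epi Q.augmentation :=
  inferInstanceAs (Epi (Q.π.f 0))

/-- The complex `⋯ ⟶ Q₁ ⟶ Q₀ ⟶ P` obtained by splicing a projective resolution `Q` of `K` with a
morphism `K ⟶ P`. -/
def splice (Q : ProjectiveResolution K) (i : K ⟶ P) : ChainComplex C ℕ :=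
  ChainComplex.augment Q.complex (Q.augmentation ≫ i) (by
    rw [← Category.assoc, Q.d_comp_augmentation, zero_comp])

/-- Composing the augmentation with a monomorphism does not change its kernel. -/
lemma splice_exactAt_one (Q : ProjectiveResolution K) (i : K ⟶ P) [Mono i] :
    (Q.splice i).ExactAt 1 := by
  rw [HomologicalComplex.exactAt_iff' _ 2 1 0 (by simp) (by simp)]
  let φ : ShortComplex.mk _ _ Q.d_comp_augmentation ⟶ (Q.splice i).sc' 2 1 0 :=
    { τ₁ := 𝟙 _
      τ₂ := 𝟙 _
      τ₃ := i
      comm₁₂ := (Category.id_comp _).trans (Category.comp_id _).symm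
      comm₂₃ := Category.id_comp _ }
  have : Epi φ.τ₁ := inferInstanceAs (Epi (𝟙 (Q.complex.X 1)))
  have : IsIso φ.τ₂ := inferInstanceAs (IsIso (𝟙 (Q.complex.X 0)))
  have : Mono φ.τ₃ := inferInstanceAs (Mono i)
  exact (ShortComplex.exact_iff_of_epi_of_isIso_of_mono φ).1 Q.exact_augmentation

lemma splice_exactAt (Q : ProjectiveResolution K) (i : K ⟶ P) [Mono i] (n : ℕ) :
    (Q.splice i).ExactAt (n + 1) := by
  cases n with
  | zero => exact splice_exactAt_one Q i
  | succ n =>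
    rw [HomologicalComplex.exactAt_iff' _ (n + 3) (n + 2) (n + 1) (by simp) (by simp)]
    exact Q.exact_succ n

/-- The projective resolution of `N` obtained by splicing a projective resolution of `K` with a
short exact sequence `0 ⟶ K ⟶ P ⟶ N ⟶ 0`. -/
def ofSplice (Q : ProjectiveResolution K) (S : ShortComplex C) (e : K ⟶ S.X₁) [IsIso e]
    (hS : S.ShortExact) [hP : Projective S.X₂] : ProjectiveResolution S.X₃ :=
  have := hS.mono_f
  have := hS.epi_g
  have w : (Q.splice (e ≫ S.f)).d 1 0 ≫ S.g = 0 := by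
    change (Q.augmentation ≫ e ≫ S.f) ≫ S.g = 0
    simp
  { complex := Q.splice (e ≫ S.f)
    projective := fun n => by
      cases n with
      | zero => exact hP
      | succ n => exact Q.projective n
    π := (ChainComplex.toSingle₀Equiv _ _).symm ⟨S.g, w⟩
    quasiIso := ⟨fun n => by
      cases n with
      | zero =>
        rw [ChainComplex.quasiIsoAt₀_iff, ShortComplex.quasiIso_iff_of_zeros' _ rfl rfl rfl]
        -- In degree zero the claim is exactness of `Q₀ ⟶ P ⟶ N ⟶ 0`. It is inherited from `S`,
        -- because `Q₀ ⟶ K` is an epimorphism and so `Q₀` and `K` have the same image in `P`.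
        let T : ShortComplex C := ShortComplex.mk (Q.augmentation ≫ e ≫ S.f) S.g w
        have hT : T.Exact ∧ Epi T.g := by
          refine ⟨?_, hS.epi_g⟩
          let φ : T ⟶ S :=
            { τ₁ := Q.augmentation ≫ e
              τ₂ := 𝟙 _
              τ₃ := 𝟙 _
              comm₁₂ := by simp [T]
              comm₂₃ := by simp [T] }
          have : Epi φ.τ₁ := inferInstanceAs (Epi (Q.augmentation ≫ e))
          have : IsIso φ.τ₂ := inferInstanceAs (IsIso (𝟙 S.X₂))
          have : Mono φ.τ₃ := inferInstanceAs (Mono (𝟙 S.X₃))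
          exact (ShortComplex.exact_iff_of_epi_of_isIso_of_mono φ).2 hS.exact
        refine (ShortComplex.exact_and_epi_g_iff_of_iso ?_).2 hT
        refine ShortComplex.isoMk (Iso.refl _) (Iso.refl _) (Iso.refl _) ?_ ?_
        · exact (Category.id_comp _).trans (Category.comp_id _).symm
        · refine (Category.id_comp _).trans (Eq.trans ?_ (Category.comp_id _).symm)
          exact (ChainComplex.toSingle₀Equiv_symm_apply_f_zero (C := Q.splice (e ≫ S.f))
            S.g w).symm
      | succ n =>
        rw [quasiIsoAt_iff_exactAt']
        · apply splice_exactAt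
        · apply ChainComplex.exactAt_succ_single_obj⟩ }

end CategoryTheory.ProjectiveResolution

namespace CategoryTheory.ProjectiveResolution

open CategoryTheory.Limits

variable {C D : Type*} [Category* C] [Abelian C] [HasProjectiveResolutions C] [Category* D]
  [Abelian D]

/-- Dimension shifting for left derived functors. -/
theorem leftDerived_shift (F : C ⥤ D) [F.Additive] (S : ShortComplex C) (hS : S.ShortExact)
    [Projective S.X₂] (i : ℕ) :
    Nonempty ((F.leftDerived (i + 2)).obj S.X₃ ≅ (F.leftDerived (i + 1)).obj S.X₁) := by
  obtain ⟨Q⟩ := (HasProjectiveResolutions.out S.X₁).out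
  let Q' := ofSplice Q S (𝟙 _) hS
  let K := (F.mapHomologicalComplex (ComplexShape.down ℕ)).obj Q.complex
  let K' := (F.mapHomologicalComplex (ComplexShape.down ℕ)).obj Q'.complex
  -- The spliced complex is the old one shifted by one. Around degree `i + 2` the new differential
  -- `Q₀ ⟶ P` does not occur, so the two three-term pieces agree definitionally.
  let e : K'.sc' (i + 3) (i + 2) (i + 1) ≅ K.sc' (i + 2) (i + 1) i := Iso.refl _
  exact ⟨Q'.isoLeftDerivedObj F (i + 2) ≪≫
    ShortComplex.homologyMapIso (K'.isoSc' (i + 3) (i + 2) (i + 1) (by simp) (by simp)) ≪≫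
    ShortComplex.homologyMapIso e ≪≫
    (ShortComplex.homologyMapIso (K.isoSc' (i + 2) (i + 1) i (by simp) (by simp))).symm ≪≫
    (Q.isoLeftDerivedObj F (i + 1)).symm⟩

/-- The first left derived functor as a homology object. -/
theorem leftDerived_one (F : C ⥤ D) [F.Additive] (S : ShortComplex C) (hS : S.ShortExact)
    [Projective S.X₂] (Q : ProjectiveResolution S.X₁) :
    Nonempty ((F.leftDerived 1).obj S.X₃ ≅
      (ShortComplex.mk (F.map (Q.complex.d 1 0)) (F.map (Q.augmentation ≫ S.f)) (by
        rw [← F.map_comp, ← Category.assoc, Q.d_comp_augmentation, zero_comp,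
          F.map_zero])).homology) := by
  let Q' := ofSplice Q S (𝟙 _) hS
  let K' := (F.mapHomologicalComplex (ComplexShape.down ℕ)).obj Q'.complex
  let T := ShortComplex.mk (F.map (Q.complex.d 1 0)) (F.map (Q.augmentation ≫ S.f)) (by
    rw [← F.map_comp, ← Category.assoc, Q.d_comp_augmentation, zero_comp, F.map_zero])
  have e : K'.sc' 2 1 0 ≅ T := by
    refine ShortComplex.isoMk (Iso.refl (F.obj (Q.complex.X 1)))
      (Iso.refl (F.obj (Q.complex.X 0))) (Iso.refl (F.obj S.X₂)) ?_ ?_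
    · exact (Category.id_comp _).trans (Category.comp_id _).symm
    · refine (Category.id_comp _).trans (Eq.trans ?_ (Category.comp_id _).symm)
      change _ = F.map (Q.augmentation ≫ 𝟙 _ ≫ S.f)
      rw [Category.id_comp]
  exact ⟨Q'.isoLeftDerivedObj F 1 ≪≫
    ShortComplex.homologyMapIso (K'.isoSc' 2 1 0 (by simp) (by simp)) ≪≫
    ShortComplex.homologyMapIso e⟩

end CategoryTheory.ProjectiveResolution

/-! ### Tor through syzygies and square matrices -/

section

variable {R : Type*} [CommRing R]

/-- For `X → Y → Z` with `X → Y` surjective with kernel the image of `W → X`, the homology of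
`W → X → Z` is the kernel of `Y → Z`. -/
def kerCompQuotEquiv {W X Y Z : Type*} [AddCommGroup W] [Module R W] [AddCommGroup X] [Module R X]
    [AddCommGroup Y] [Module R Y] [AddCommGroup Z] [Module R Z] (b : W →ₗ[R] X) (f : X →ₗ[R] Y)
    (g : Y →ₗ[R] Z) (hf : Function.Surjective f) (hbf : Function.Exact b f) (c : X →ₗ[R] Z)
    (hc : c = g ∘ₗ f) :
    (LinearMap.ker c ⧸ (LinearMap.range b).submoduleOf (LinearMap.ker c)) ≃ₗ[R] LinearMap.ker g :=
  let φ : LinearMap.ker c →ₗ[R] LinearMap.ker g :=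
    (f ∘ₗ (LinearMap.ker c).subtype).codRestrict _ fun x => by
      rw [LinearMap.mem_ker, ← LinearMap.comp_apply, ← LinearMap.comp_assoc, ← hc]
      exact x.2
  have hφ : Function.Surjective φ := fun y => by
    obtain ⟨x, hx⟩ := hf y
    exact ⟨⟨x, by simp [hc, hx]⟩, Subtype.ext hx⟩
  (Submodule.quotEquivOfEq _ _ (by
    ext x
    rw [LinearMap.mem_ker]
    change x.1 ∈ Set.range b ↔ _
    rw [← hbf]
    exact (Subtype.ext_iff (a1 := φ x) (a2 := 0)).symm)).trans (φ.quotKerEquivOfSurjective hφ)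

end

section Tor

variable {R : Type u} [CommRing R] {M K P N : Type u} [AddCommGroup M] [Module R M]
    [AddCommGroup K] [Module R K] [AddCommGroup P] [Module R P] [AddCommGroup N] [Module R N]

lemma shortExact_of_exact (i : K →ₗ[R] P) (p : P →ₗ[R] N) (hi : Function.Injective i)
    (hp : Function.Surjective p) (hip : Function.Exact i p) :
    (ModuleCat.ofHom i ≫ ModuleCat.ofHom p = 0) ∧
    ∀ w, (ShortComplex.mk (ModuleCat.ofHom i) (ModuleCat.ofHom p) w).ShortExact := by
  refine ⟨by ext x; exact (hip (i x)).2 ⟨x, rfl⟩, fun w => ?_⟩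
  refine { exact := ?_, mono_f := ?_, epi_g := ?_ }
  · exact (ShortComplex.ShortExact.moduleCat_exact_iff_function_exact _).2 hip
  · exact (ModuleCat.mono_iff_injective _).2 hi
  · exact (ModuleCat.epi_iff_surjective _).2 hp

/-- `Tor` is defined as the left derived functor of `M ⊗ -`, so syzygies are taken in the second
argument only and `M` is arbitrary. -/
theorem torModule_shift (M : Type u) [AddCommGroup M] [Module R M] [Module.Projective R P]
    (i : K →ₗ[R] P) (p : P →ₗ[R] N) (hi : Function.Injective i)
    (hp : Function.Surjective p) (hip : Function.Exact i p) (n : ℕ) :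
    Nonempty (torModule R M N (n + 2) ≃ₗ[R] torModule R M K (n + 1)) := by
  obtain ⟨w, hS⟩ := shortExact_of_exact i p hi hp hip
  have : Projective (ModuleCat.of R P) := (IsProjective.iff_projective P).1 inferInstance
  obtain ⟨e⟩ := ProjectiveResolution.leftDerived_shift
    ((MonoidalCategory.tensoringLeft (ModuleCat R)).obj (ModuleCat.of R M)) _ (hS w) n
  exact ⟨e.toLinearEquiv⟩

/-- By right exactness of the tensor product, `M ⊗ Q₀` modulo the image of `M ⊗ Q₁` is `M ⊗ K`; the
homology of `M ⊗ Q₁ → M ⊗ Q₀ → M ⊗ P` is therefore a kernel on `M ⊗ K`. -/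
theorem torModule_one (M : Type u) [AddCommGroup M] [Module R M] [Module.Projective R P]
    (i : K →ₗ[R] P) (p : P →ₗ[R] N) (hi : Function.Injective i)
    (hp : Function.Surjective p) (hip : Function.Exact i p) :
    Nonempty (torModule R M N 1 ≃ₗ[R] LinearMap.ker (i.lTensor M)) := by
  obtain ⟨w, hS⟩ := shortExact_of_exact i p hi hp hip
  have : Projective (ModuleCat.of R P) := (IsProjective.iff_projective P).1 inferInstance
  obtain ⟨Q⟩ := (HasProjectiveResolutions.out (ModuleCat.of R K)).out
  obtain ⟨e⟩ := ProjectiveResolution.leftDerived_one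
    ((MonoidalCategory.tensoringLeft (ModuleCat R)).obj (ModuleCat.of R M)) _ (hS w) Q
  have h1 : Function.Exact (Q.complex.d 1 0).hom Q.augmentation.hom :=
    (ShortComplex.ShortExact.moduleCat_exact_iff_function_exact _).1 Q.exact_augmentation
  have h2 : Function.Surjective Q.augmentation.hom :=
    (ModuleCat.epi_iff_surjective _).1 inferInstance
  refine ⟨e.toLinearEquiv.trans ((ShortComplex.moduleCatHomologyIso _).toLinearEquiv.trans
    ((Submodule.quotEquivOfEq _ _ ?_).trans
    (kerCompQuotEquiv ((Q.complex.d 1 0).hom.lTensor M) (Q.augmentation.hom.lTensor M)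
      (i.lTensor M) (LinearMap.lTensor_surjective M h2) (lTensor_exact M h1 h2) _ ?_)))⟩
  · ext x
    constructor
    · rintro ⟨y, rfl⟩
      exact ⟨y, rfl⟩
    · rintro ⟨y, hy⟩
      exact ⟨y, Subtype.ext hy⟩
  · rw [← LinearMap.lTensor_comp]
    rfl

end Tor

section MatAct

variable {R : Type*} [CommRing R] {ι : Type*} [Fintype ι]
  (M : Type*) [AddCommGroup M] [Module R M]

/-- The action of a square matrix on `Mⁿ`. -/
def matAct (A : Matrix ι ι R) : (ι → M) →ₗ[R] (ι → M) :=
  LinearMap.pi fun i => ∑ j, A i j • LinearMap.proj j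

variable {M}

lemma matAct_apply (A : Matrix ι ι R) (v : ι → M) (i : ι) :
    matAct M A v i = ∑ j, A i j • v j := by
  simp [matAct]

lemma matAct_mul_apply (A B : Matrix ι ι R) (v : ι → M) :
    matAct M (A * B) v = matAct M A (matAct M B v) := by
  ext i
  simp only [matAct_apply, Matrix.mul_apply, Finset.sum_smul, Finset.smul_sum, mul_smul]
  exact Finset.sum_comm

lemma matAct_add_apply (A B : Matrix ι ι R) (v : ι → M) :
    matAct M (A + B) v = matAct M A v + matAct M B v := by
  ext i
  simp [matAct_apply, add_smul, Finset.sum_add_distrib]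

lemma matAct_scalar_apply [DecidableEq ι] (c : R) (v : ι → M) :
    matAct M (Matrix.scalar ι c) v = c • v := by
  ext i
  simp [matAct_apply, Matrix.diagonal_apply]

variable (M) in
/-- The homology of `Mⁿ → Mⁿ → Mⁿ`, where the first map is given by the matrix `B` and the second
one by `A`. -/
abbrev MatHomology (A B : Matrix ι ι R) : Type _ :=
  LinearMap.ker (matAct M A) ⧸ (LinearMap.range (matAct M B)).submoduleOf (LinearMap.ker (matAct M A))

/-- Naturality of `M ⊗ Rⁿ ≃ Mⁿ` in endomorphisms of `Rⁿ`; it moves the computation of Tor from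
tensor products to `Mⁿ`. -/
lemma matAct_comp_piScalarRight [DecidableEq ι] (A : Matrix ι ι R) :
    matAct M A ∘ₗ (TensorProduct.piScalarRight R R M ι).toLinearMap =
      (TensorProduct.piScalarRight R R M ι).toLinearMap ∘ₗ (matAct R A).lTensor M := by
  apply TensorProduct.ext'
  intro x v
  ext i
  simp [matAct_apply, Finset.sum_smul, mul_smul]

end MatAct

section Tor

variable {R : Type u} [CommRing R] (M : Type u) [AddCommGroup M] [Module R M] {m : ℕ}

/-- The first syzygy of `Z` is the image of `A`, which is presented by `B`. Tensoring that
presentation with `M` identifies `ker (M ⊗ im A → Mᵐ)` with `ker A / im B`. -/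
theorem torModule_one_matrix (A B : Matrix (Fin m) (Fin m) R)
    (hBA : Function.Exact (matAct R B) (matAct R A)) {Z : Type u} [AddCommGroup Z] [Module R Z]
    (p : (Fin m → R) →ₗ[R] Z) (hp : Function.Surjective p) (hAp : Function.Exact (matAct R A) p) :
    Nonempty (torModule R M Z 1 ≃ₗ[R] MatHomology M A B) := by
  let i := (LinearMap.range (matAct R A)).subtype
  let s := (matAct R A).rangeRestrict
  have hs : Function.Surjective s := (matAct R A).surjective_rangeRestrict
  have his : i ∘ₗ s = matAct R A := rfl
  have hBs : Function.Exact (matAct R B) s := fun x => by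
    rw [← hBA x]
    exact Subtype.ext_iff
  have hip : Function.Exact i p := fun x => by
    rw [hAp x]
    simp [i]
  obtain ⟨e₁⟩ := torModule_one M i p (Submodule.injective_subtype _) hp hip
  let e := TensorProduct.piScalarRight R R M (Fin m)
  have key (C : Matrix (Fin m) (Fin m) R) (x) :
      matAct M C (e x) = e ((matAct R C).lTensor M x) :=
    LinearMap.congr_fun (matAct_comp_piScalarRight C) x
  let e₂ := kerCompQuotEquiv (matAct M B) (s.lTensor M ∘ₗ e.symm.toLinearMap)
    (e.toLinearMap ∘ₗ i.lTensor M)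
    ((LinearMap.lTensor_surjective M hs).comp e.symm.surjective) (fun x => by
      obtain ⟨x, rfl⟩ := e.surjective x
      simp only [LinearMap.comp_apply, LinearEquiv.coe_coe, LinearEquiv.symm_apply_apply]
      rw [lTensor_exact M hBs hs x]
      constructor
      · rintro ⟨y, rfl⟩
        exact ⟨e y, key _ _⟩
      · rintro ⟨y, hy⟩
        obtain ⟨y, rfl⟩ := e.surjective y
        rw [key] at hy
        exact ⟨y, e.injective hy⟩) (matAct M A) (by
      refine LinearMap.ext fun x => ?_
      obtain ⟨x, rfl⟩ := e.surjective x
      simp only [LinearMap.comp_apply, LinearEquiv.coe_coe, LinearEquiv.symm_apply_apply]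
      rw [key, ← LinearMap.lTensor_comp_apply, his])
  exact ⟨e₁.trans ((LinearEquiv.ofEq _ _ (LinearEquiv.ker_comp e _).symm).trans e₂.symm)⟩

/-- The syzygy of `coker A` is `im A ≅ coker B`, and that of `coker B` is `im B ≅ coker A`. Each
dimension shift thus exchanges the two matrices, which is why `A`, `B` and `Z` are quantified inside
the induction. -/
theorem torModule_matrix (j : ℕ) : ∀ (A B : Matrix (Fin m) (Fin m) R)
    (_ : Function.Exact (matAct R B) (matAct R A)) (_ : Function.Exact (matAct R A) (matAct R B))
    {Z : Type u} [AddCommGroup Z] [Module R Z] (p : (Fin m → R) →ₗ[R] Z)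
    (_ : Function.Surjective p) (_ : Function.Exact (matAct R A) p),
    Nonempty (torModule R M Z (2 * j + 1) ≃ₗ[R] MatHomology M A B) ∧
    Nonempty (torModule R M Z (2 * j + 2) ≃ₗ[R] MatHomology M B A) := by
  have shift : ∀ (A B : Matrix (Fin m) (Fin m) R)
    (_ : Function.Exact (matAct R B) (matAct R A))
    {Z : Type u} [AddCommGroup Z] [Module R Z] (p : (Fin m → R) →ₗ[R] Z)
    (_ : Function.Surjective p) (_ : Function.Exact (matAct R A) p) (n : ℕ),
    ∃ p' : (Fin m → R) →ₗ[R] LinearMap.range (matAct R A), Function.Surjective p' ∧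
      Function.Exact (matAct R B) p' ∧
      Nonempty (torModule R M Z (n + 2) ≃ₗ[R]
        torModule R M (LinearMap.range (matAct R A)) (n + 1)) := by
    intro A B hBA Z _ _ p hp hAp n
    refine ⟨(matAct R A).rangeRestrict, (matAct R A).surjective_rangeRestrict, fun x => ?_,
      torModule_shift M (LinearMap.range (matAct R A)).subtype p
        (Submodule.injective_subtype _) hp (fun x => ?_) n⟩
    · rw [← hBA x]
      exact Subtype.ext_iff
    · rw [hAp x]
      simp
  induction j with
  | zero =>
    intro A B hBA hAB Z _ _ p hp hAp
    obtain ⟨p', hp', hBp', ⟨e⟩⟩ := shift A B hBA p hp hAp 0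
    obtain ⟨e'⟩ := torModule_one_matrix M B A hAB p' hp' hBp'
    exact ⟨torModule_one_matrix M A B hBA p hp hAp, ⟨e.trans e'⟩⟩
  | succ j ih =>
    intro A B hBA hAB Z _ _ p hp hAp
    -- Both degrees are brought down to `2 * j + 2`: the odd one by one shift, which swaps the
    -- matrices, the even one by two shifts, which restore them.
    obtain ⟨p', hp', hBp', ⟨e⟩⟩ := shift A B hBA p hp hAp (2 * j + 1)
    obtain ⟨p₂, hp₂, hBp₂, ⟨e₂⟩⟩ := shift A B hBA p hp hAp (2 * j + 2)
    obtain ⟨-, ⟨e'⟩⟩ := ih B A hAB hBA p' hp' hBp'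
    obtain ⟨p₃, hp₃, hBp₃, ⟨e₃⟩⟩ := shift B A hAB p₂ hp₂ hBp₂ (2 * j + 1)
    obtain ⟨-, ⟨e₄⟩⟩ := ih A B hBA hAB p₃ hp₃ hBp₃
    exact ⟨⟨e.trans e'⟩, ⟨e₂.trans (e₃.trans e₄)⟩⟩

end Tor

/-! ### Reduction modulo a regular element -/

section Fibre

/-- `R' = R / tR` with `t` a nonzerodivisor of `R`. -/
structure IsRingFibre {R R' : Type*} [CommRing R] [CommRing R'] (φ : R →+* R') (t : R) :
    Prop where
  surjective : Function.Surjective φ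
  eq_zero_iff : ∀ r, φ r = 0 ↔ t ∣ r
  regular : ∀ r, t * r = 0 → r = 0

/-- `M' = M / tM` with `t` acting injectively on `M`. -/
structure IsModuleFibre {R R' : Type*} [CommRing R] [CommRing R'] {φ : R →+* R'} (t : R)
    {M M' : Type*} [AddCommGroup M] [Module R M] [AddCommGroup M'] [Module R' M']
    (q : M →ₛₗ[φ] M') : Prop where
  surjective : Function.Surjective q
  eq_zero_iff : ∀ m, q m = 0 ↔ ∃ n, m = t • n
  regular : ∀ m : M, t • m = 0 → m = 0

variable {R R' : Type*} [CommRing R] [CommRing R'] {φ : R →+* R'} {t : R}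
    {M M' : Type*} [AddCommGroup M] [Module R M] [AddCommGroup M'] [Module R' M']
    {q : M →ₛₗ[φ] M'} {ι : Type*}

lemma IsRingFibre.lift_fun (hφ : IsRingFibre φ t) (v' : ι → R') : ∃ v : ι → R, φ ∘ v = v' := by
  choose g hg using hφ.surjective
  exact ⟨g ∘ v', funext fun i => hg _⟩

lemma IsRingFibre.exists_smul_fun (hφ : IsRingFibre φ t) (v : ι → R) (h : φ ∘ v = 0) :
    ∃ w : ι → R, v = t • w := by
  have : ∀ i, ∃ w, v i = t * w := fun i => (hφ.eq_zero_iff _).1 (congrFun h i)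
  choose w hw using this
  exact ⟨w, funext hw⟩

variable [Fintype ι]

lemma map_linearCombination (q : M →ₛₗ[φ] M') (z : ι → M) (v : ι → R) :
    q (Fintype.linearCombination R z v) =
      Fintype.linearCombination R' (q ∘ z) (φ ∘ v) := by
  simp [Fintype.linearCombination_apply]

lemma IsModuleFibre.linearCombination_surjective
    (hq : IsModuleFibre t q) (z : ι → M)
    (hz : Function.Surjective (Fintype.linearCombination R z)) :
    Function.Surjective (Fintype.linearCombination R' (q ∘ z)) := fun m' => by
  obtain ⟨m, rfl⟩ := hq.surjective m'
  obtain ⟨v, rfl⟩ := hz m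
  exact ⟨φ ∘ v, (map_linearCombination q z v).symm⟩

/-- The map between the kernels of two compatible finite free presentations. -/
def kerFibreMap (q : M →ₛₗ[φ] M') (z : ι → M) :
    LinearMap.ker (Fintype.linearCombination R z) →ₛₗ[φ]
      LinearMap.ker (Fintype.linearCombination R' (q ∘ z)) where
  toFun v := ⟨φ ∘ v.1, by
    rw [LinearMap.mem_ker, ← map_linearCombination, LinearMap.mem_ker.1 v.2, map_zero]⟩
  map_add' v w := by ext i; simp
  map_smul' c v := by ext i; simp

/-- Because `t` is regular on `M`, reduction modulo `t` keeps `0 → K → Rⁿ → M → 0` exact, so the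
reduction of a syzygy is a syzygy of the reduction. -/
lemma IsModuleFibre.ker (hφ : IsRingFibre φ t) (hq : IsModuleFibre t q) (z : ι → M)
    (hz : Function.Surjective (Fintype.linearCombination R z)) :
    IsModuleFibre t (kerFibreMap q z) where
  surjective := by
    rintro ⟨v', hv'⟩
    obtain ⟨v, rfl⟩ := hφ.lift_fun v'
    rw [LinearMap.mem_ker, ← map_linearCombination, hq.eq_zero_iff] at hv'
    obtain ⟨n, hn⟩ := hv'
    obtain ⟨u, rfl⟩ := hz n
    -- An arbitrary lift `v` is a relation only up to some `t • n`; writing `n` as a combination of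
    -- the generators with coefficients `u` corrects it without changing its reduction.
    refine ⟨⟨v - t • u, by simp [hn]⟩, Subtype.ext (funext fun i => ?_)⟩
    have : φ t = 0 := (hφ.eq_zero_iff t).2 dvd_rfl
    simp [kerFibreMap, this]
  eq_zero_iff := by
    rintro ⟨v, hv⟩
    constructor
    · intro h
      obtain ⟨w, rfl⟩ := hφ.exists_smul_fun v (congrArg Subtype.val h)
      refine ⟨⟨w, hq.regular _ ?_⟩, rfl⟩
      rw [← map_smul]
      exact hv
    · rintro ⟨w, hw⟩
      have : φ t = 0 := (hφ.eq_zero_iff t).2 dvd_rfl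
      rw [hw, map_smulₛₗ, this, zero_smul]
  regular := by
    rintro ⟨v, hv⟩ h
    ext i
    exact hφ.regular _ (congrFun (congrArg Subtype.val h) i)

/-- Freeness lifts from the fibre. -/
lemma IsModuleFibre.free [IsLocalRing R] [IsNoetherianRing R] [Module.Finite R M]
    [Module.Finite R' M'] [Module.Free R' M'] [Nontrivial R']
    (hφ : IsRingFibre φ t) (hq : IsModuleFibre t q) (ht : t ∈ IsLocalRing.maximalIdeal R) :
    Module.Free R M := by
  let b' := Module.finBasis R' M'
  choose g hg using hq.surjective
  let e := fun i => g (b' i)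
  have hqe : q ∘ e = b' := funext fun i => hg _
  let f := Fintype.linearCombination R e
  have hqf (v) : q (f v) = Fintype.linearCombination R' b' (φ ∘ v) := by
    rw [← hqe]; exact map_linearCombination q e v
  have hjac : Ideal.span {t} ≤ Ideal.jacobson ⊥ := by
    rw [Ideal.span_singleton_le_iff_mem]
    exact IsLocalRing.maximalIdeal_le_jacobson _ ht
  -- Nakayama's lemma: `range f + tM = M`.
  have hsurj : Function.Surjective f := by
    rw [← LinearMap.range_eq_top, ← top_le_iff]
    refine Submodule.le_of_le_smul_of_le_jacobson_bot Module.Finite.fg_top hjac fun m _ => ?_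
    obtain ⟨v, hv⟩ := hφ.lift_fun (b'.equivFun (q m))
    have h0 : q (m - f v) = 0 := by
      rw [map_sub, hqf, hv, sub_eq_zero]
      simp [Fintype.linearCombination_apply, b'.sum_repr]
    obtain ⟨n, hn⟩ := (hq.eq_zero_iff _).1 h0
    rw [sub_eq_iff_eq_add, add_comm] at hn
    rw [hn]
    exact Submodule.add_mem_sup ⟨v, rfl⟩ (Submodule.smul_mem_smul
      (Ideal.mem_span_singleton_self t) trivial)
  -- Nakayama's lemma again: a relation vanishes modulo `t`, and dividing it by `t` gives another
  -- relation since `t` is regular on `M`. Hence `ker f = t · ker f`.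
  have hinj : Function.Injective f := by
    rw [← LinearMap.ker_eq_bot]
    refine Submodule.eq_bot_of_le_smul_of_le_jacobson_bot (Ideal.span {t}) _
      (IsNoetherian.noetherian _) (fun v hv => ?_) hjac
    have h0 : φ ∘ v = 0 := by
      have h1 := hqf v
      rw [LinearMap.mem_ker.1 hv, map_zero, Fintype.linearCombination_apply] at h1
      exact funext fun i => Fintype.linearIndependent_iff.1 b'.linearIndependent _ h1.symm i
    obtain ⟨w, rfl⟩ := hφ.exists_smul_fun v h0
    refine Submodule.smul_mem_smul (Ideal.mem_span_singleton_self t) (hq.regular _ ?_)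
    rw [← map_smul]
    exact hv
  exact Module.Free.of_equiv (LinearEquiv.ofBijective f ⟨hinj, hsurj⟩)

lemma exists_linearCombination_surjective (R M : Type*) [CommRing R] [AddCommGroup M] [Module R M]
    [Module.Finite R M] :
    ∃ (n : ℕ) (z : Fin n → M), Function.Surjective (Fintype.linearCombination R z) := by
  obtain ⟨n, z, hz⟩ := Module.Finite.exists_fin (R := R) (M := M)
  exact ⟨n, z, by rw [← LinearMap.range_eq_top, Fintype.range_linearCombination, hz]⟩

end Fibre

/-! ### Projective dimension and its behaviour under reduction -/

section ProjectiveDimension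

lemma shortExact_ker {R : Type u} [CommRing R] {P N : Type u} [AddCommGroup P] [Module R P]
    [AddCommGroup N] [Module R N] (p : P →ₗ[R] N) (hp : Function.Surjective p) :
    ∃ w, (ShortComplex.mk (ModuleCat.ofHom (LinearMap.ker p).subtype)
      (ModuleCat.ofHom p) w).ShortExact := by
  obtain ⟨w, h⟩ := shortExact_of_exact (LinearMap.ker p).subtype p
    (Submodule.injective_subtype _) hp (LinearMap.exact_subtype_ker_map p)
  exact ⟨w, h w⟩

lemma hasProjectiveDimensionLT_ker_iff {R : Type u} [CommRing R] {P N : Type u} [AddCommGroup P]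
    [Module R P] [AddCommGroup N] [Module R N] [Module.Projective R P] (p : P →ₗ[R] N)
    (hp : Function.Surjective p) (d : ℕ) :
    HasProjectiveDimensionLT (ModuleCat.of R N) (d + 2) ↔
      HasProjectiveDimensionLT (ModuleCat.of R (LinearMap.ker p)) (d + 1) := by
  obtain ⟨w, h⟩ := shortExact_ker p hp
  exact h.hasProjectiveDimensionLT_X₃_iff d ((IsProjective.iff_projective P).1 inferInstance)

lemma hasProjectiveDimensionLT_one_iff {R : Type u} [CommRing R] {N : Type u}
    [AddCommGroup N] [Module R N] :
    HasProjectiveDimensionLT (ModuleCat.of R N) 1 ↔ Module.Projective R N := by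
  rw [← projective_iff_hasProjectiveDimensionLT_one, ← IsProjective.iff_projective]

variable {R R' : Type u} [CommRing R] [CommRing R'] {φ : R →+* R'} {t : R}

/-- Syzygies reduce to syzygies, so a resolution of the fibre that stops at a free module is matched
by one over `R`; the last step is the lifting of freeness. -/
theorem IsModuleFibre.hasProjectiveDimensionLT [IsLocalRing R] [IsNoetherianRing R]
    [IsLocalRing R'] (hφ : IsRingFibre φ t) (ht : t ∈ IsLocalRing.maximalIdeal R) (d : ℕ) :
    ∀ {M M' : Type u} [AddCommGroup M] [Module R M] [AddCommGroup M'] [Module R' M']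
      [Module.Finite R M] {q : M →ₛₗ[φ] M'} (_ : IsModuleFibre t q)
      (_ : HasProjectiveDimensionLT (ModuleCat.of R' M') (d + 1)),
      HasProjectiveDimensionLT (ModuleCat.of R M) (d + 1) := by
  have : RingHomSurjective φ := ⟨hφ.surjective⟩
  induction d with
  | zero =>
    intro M M' _ _ _ _ _ q hq h
    have : Module.Finite R' M' := Module.Finite.of_surjective q hq.surjective
    rw [zero_add, hasProjectiveDimensionLT_one_iff] at h ⊢
    have : Module.Free R' M' := Module.free_of_flat_of_isLocalRing
    have := hq.free hφ ht
    infer_instance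
  | succ d ih =>
    intro M M' _ _ _ _ _ q hq h
    obtain ⟨n, z, hz⟩ := exists_linearCombination_surjective R M
    have hz' := hq.linearCombination_surjective z hz
    rw [hasProjectiveDimensionLT_ker_iff _ hz]
    rw [hasProjectiveDimensionLT_ker_iff _ hz'] at h
    exact ih (hq.ker hφ z hz) h

end ProjectiveDimension

/-! ### Matrix factorizations and two-periodic tails of Tor -/

section MatrixFactorization

variable {S R : Type*} [CommRing S] [CommRing R] [Algebra S R] {m : ℕ}

lemma matAct_map_apply {S R : Type*} [CommRing S] [CommRing R] (φ : S →+* R) {m : ℕ}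
    (A : Matrix (Fin m) (Fin m) S) (v : Fin m → S) :
    matAct R (A.map φ) (φ ∘ v) = φ ∘ matAct S A v := by
  ext i
  simp [matAct_apply]

lemma scalar_smul_eq_matAct (F : S) {A B : Matrix (Fin m) (Fin m) S}
    (hAB : A * B = Matrix.scalar (Fin m) F) (v : Fin m → S) :
    matAct S A (matAct S B v) = F • v := by
  rw [← matAct_mul_apply, hAB, matAct_scalar_apply]

/-- A matrix factorization of a nonzerodivisor `F` gives an exact pair over `S / F`. -/
lemma exact_of_matrixFactorization {F : S} (hF : ∀ s, F * s = 0 → s = 0)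
    (hsurj : Function.Surjective (algebraMap S R))
    (hker : ∀ s, algebraMap S R s = 0 ↔ F ∣ s) {A B : Matrix (Fin m) (Fin m) S}
    (hAB : A * B = Matrix.scalar (Fin m) F) (hBA : B * A = Matrix.scalar (Fin m) F) :
    Function.Exact (matAct R (A.map (algebraMap S R))) (matAct R (B.map (algebraMap S R))) := by
  have hφ : IsRingFibre (algebraMap S R) F := ⟨hsurj, hker, hF⟩
  have hF0 : algebraMap S R F = 0 := (hker F).2 dvd_rfl
  intro v
  obtain ⟨v, rfl⟩ := hφ.lift_fun v
  constructor
  · intro h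
    rw [matAct_map_apply] at h
    obtain ⟨w, hw⟩ := hφ.exists_smul_fun _ h
    -- With `B v = F w` one has `F (v - A w) = A (B v - F w) = 0`, and `F` can be cancelled.
    have h0 : F • (v - matAct S A w) = 0 := by
      rw [← scalar_smul_eq_matAct F hAB, map_sub, hw, scalar_smul_eq_matAct F hBA, sub_self,
        map_zero]
    have h1 : v = matAct S A w := by
      ext i
      exact sub_eq_zero.1 (hF _ (congrFun h0 i))
    exact ⟨algebraMap S R ∘ w, by rw [matAct_map_apply, ← h1]⟩
  · rintro ⟨w, hw⟩
    obtain ⟨w, rfl⟩ := hφ.lift_fun w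
    rw [← hw, matAct_map_apply, matAct_map_apply, scalar_smul_eq_matAct F hBA]
    ext i
    simp [hF0]

/-- The two-periodic tail of `Tor` of `N` is computed by the matrix factorization `(A, B)`, from
the degree `k + 1` on. -/
def IsTorTail {R : Type u} [CommRing R] (N : Type u) [AddCommGroup N] [Module R N] (k : ℕ)
    (A B : Matrix (Fin m) (Fin m) R) : Prop :=
  ∀ (M : Type u) [AddCommGroup M] [Module R M] (j : ℕ),
    Nonempty (torModule R M N (k + 2 * j + 1) ≃ₗ[R] MatHomology M A B) ∧
    Nonempty (torModule R M N (k + 2 * j + 2) ≃ₗ[R] MatHomology M B A)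

/-- Forgetting one degree exchanges the matrices; this allows the starting degree to be made even.
-/
lemma IsTorTail.succ {R : Type u} [CommRing R] {N : Type u} [AddCommGroup N] [Module R N] {k : ℕ}
    {A B : Matrix (Fin m) (Fin m) R} (h : IsTorTail N k A B) : IsTorTail N (k + 1) B A :=
  fun M _ _ j => by
    rw [show k + 1 + 2 * j + 1 = k + 2 * j + 2 by ring,
      show k + 1 + 2 * j + 2 = k + 2 * (j + 1) + 1 by ring]
    exact ⟨(h M j).2, (h M (j + 1)).1⟩

lemma IsTorTail.of_ker {R : Type u} [CommRing R] {N : Type u} [AddCommGroup N] [Module R N]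
    {k n : ℕ} {A B : Matrix (Fin m) (Fin m) R} (z : Fin n → N)
    (hz : Function.Surjective (Fintype.linearCombination R z))
    (h : IsTorTail (LinearMap.ker (Fintype.linearCombination R z)) k A B) :
    IsTorTail N (k + 1) A B := fun M _ _ j => by
  have key := torModule_shift M (LinearMap.ker (Fintype.linearCombination R z)).subtype _
    (Submodule.injective_subtype _) hz (LinearMap.exact_subtype_ker_map _)
  obtain ⟨⟨e₁⟩, ⟨e₂⟩⟩ := h M j
  obtain ⟨e₃⟩ := key (k + 2 * j)
  obtain ⟨e₄⟩ := key (k + 2 * j + 1)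
  rw [show k + 1 + 2 * j + 1 = k + 2 * j + 2 by ring,
    show k + 1 + 2 * j + 2 = k + 2 * j + 1 + 2 by ring]
  exact ⟨⟨e₃.trans e₁⟩, ⟨e₄.trans e₂⟩⟩

lemma IsTorTail.of_coker {R : Type u} [CommRing R] {N : Type u} [AddCommGroup N] [Module R N]
    {A B : Matrix (Fin m) (Fin m) R} (hBA : Function.Exact (matAct R B) (matAct R A))
    (hAB : Function.Exact (matAct R A) (matAct R B)) (p : (Fin m → R) →ₗ[R] N)
    (hp : Function.Surjective p) (hAp : Function.Exact (matAct R A) p) :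
    IsTorTail N 0 A B := fun M _ _ j => by
  rw [zero_add]
  exact torModule_matrix M j A B hBA hAB p hp hAp

/-- A module of projective dimension at most one over a Noetherian local domain `S` that is killed
by `F ≠ 0` is the cokernel of a matrix factorization of `F`. -/
lemma exists_matrixFactorization_of_projectiveDimension_le_one {S : Type u} [CommRing S]
    [IsDomain S] [IsLocalRing S] [IsNoetherianRing S] {F : S} (hF : F ≠ 0) {N : Type u}
    [AddCommGroup N] [Module S N] (hFN : ∀ n : N, F • n = 0)
    (hN : HasProjectiveDimensionLT (ModuleCat.of S N) 2) (z : Fin m → N)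
    (hz : Function.Surjective (Fintype.linearCombination S z)) :
    ∃ A B : Matrix (Fin m) (Fin m) S, A * B = Matrix.scalar (Fin m) F ∧
      B * A = Matrix.scalar (Fin m) F ∧
      Function.Exact (matAct S A) (Fintype.linearCombination S z) := by
  let K := LinearMap.ker (Fintype.linearCombination S z)
  have hK : Module.Projective S K := hasProjectiveDimensionLT_one_iff.1
    ((hasProjectiveDimensionLT_ker_iff _ hz 0).1 hN)
  have : Module.Free S K := Module.free_of_flat_of_isLocalRing
  -- As `F` kills `N`, the submodule `F Sᵐ` lies in the relation module `K ⊆ Sᵐ`. This squeezes the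
  -- rank of the free module `K` to exactly `m`.
  let f : (Fin m → S) →ₗ[S] K := LinearMap.codRestrict K (F • LinearMap.id) fun v => by
    simp [K, hFN]
  have hf : Function.Injective f := fun v w h => by
    have h' := congrArg Subtype.val h
    exact smul_right_injective _ hF h'
  have hrank : Module.finrank S K = m := by
    apply le_antisymm
    · simpa using K.finrank_le
    · simpa using LinearMap.finrank_le_finrank_of_injective hf
  let e : (Fin m → S) ≃ₗ[S] K := LinearEquiv.ofFinrankEq _ _ (by simp [hrank])
  let a : (Fin m → S) →ₗ[S] (Fin m → S) := K.subtype ∘ₗ e.toLinearMap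
  let b : (Fin m → S) →ₗ[S] (Fin m → S) := e.symm.toLinearMap ∘ₗ f
  have hab : a ∘ₗ b = F • LinearMap.id := by
    refine LinearMap.ext fun v => ?_
    simp [a, b, f]
  have hinj : Function.Injective a := (Submodule.injective_subtype _).comp e.injective
  -- From `a b = F` one gets `a b a = F a = a F`, and `a` is injective.
  have hba : b ∘ₗ a = F • LinearMap.id := by
    refine LinearMap.ext fun v => hinj ?_
    have := LinearMap.congr_fun hab (a v)
    simpa using this
  have hsc : LinearMap.toMatrix' (F • (LinearMap.id : (Fin m → S) →ₗ[S] _)) =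
      Matrix.scalar (Fin m) F := by
    rw [map_smul, LinearMap.toMatrix'_id, Matrix.scalar_apply, Matrix.smul_one_eq_diagonal]
  have hact (v) : matAct S (LinearMap.toMatrix' a) v = a v := by
    have : matAct S (LinearMap.toMatrix' a) v = (LinearMap.toMatrix' a).mulVec v := by
      ext i
      simp [matAct_apply, Matrix.mulVec, dotProduct]
    rw [this, LinearMap.toMatrix'_mulVec]
  refine ⟨LinearMap.toMatrix' a, LinearMap.toMatrix' b, ?_, ?_, fun v => ?_⟩
  · rw [← LinearMap.toMatrix'_comp, hab, hsc]
  · rw [← LinearMap.toMatrix'_comp, hba, hsc]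
  · constructor
    · intro hv
      obtain ⟨w, hw⟩ := e.surjective ⟨v, hv⟩
      exact ⟨w, by rw [hact]; simp [a, hw]⟩
    · rintro ⟨w, rfl⟩
      rw [hact]
      exact (e w).2

end MatrixFactorization

/-! ### One matrix factorization for a module and its fibre -/

section Main

variable {S S' R R' : Type u} [CommRing S] [IsDomain S] [IsLocalRing S] [IsNoetherianRing S]
  [CommRing S'] [IsDomain S'] [CommRing R] [CommRing R'] [Algebra S R] [Algebra S' R']
  {ψ : S →+* S'} {φ : R →+* R'} {F : S} {t : R}

/-- Induction on the projective dimension of `N` over `S`, which drops with each `R`-syzygy until it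
is at most one; the bound `d + 2` makes that the base case. All constructions commute with reduction
modulo `t`, so the matrices found over `S` also serve `N'`. They give an exact pair there because `ψ
F` is still nonzero. -/
theorem exists_isTorTail (hcomm : φ.comp (algebraMap S R) = (algebraMap S' R').comp ψ)
    (hF : ψ F ≠ 0)
    (hR : Function.Surjective (algebraMap S R)) (hker : ∀ s, algebraMap S R s = 0 ↔ F ∣ s)
    (hR' : Function.Surjective (algebraMap S' R'))
    (hker' : ∀ s, algebraMap S' R' s = 0 ↔ ψ F ∣ s) (hφ : IsRingFibre φ t) (d : ℕ) :
    ∀ {N N' : Type u} [AddCommGroup N] [Module R N] [Module S N] [IsScalarTower S R N]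
      [Module.Finite R N] [AddCommGroup N'] [Module R' N'] {q : N →ₛₗ[φ] N'}
      (_ : IsModuleFibre t q) (_ : HasProjectiveDimensionLT (ModuleCat.of S N) (d + 2)),
    ∃ (k m : ℕ) (A B : Matrix (Fin m) (Fin m) S), A * B = Matrix.scalar (Fin m) F ∧
      B * A = Matrix.scalar (Fin m) F ∧
      IsTorTail N k (A.map (algebraMap S R)) (B.map (algebraMap S R)) ∧
      IsTorTail N' k ((A.map (algebraMap S R)).map φ) ((B.map (algebraMap S R)).map φ) := by
  have hF0 : F ≠ 0 := fun h => hF (by rw [h, map_zero])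
  have hφS : IsRingFibre (algebraMap S R) F :=
    ⟨hR, hker, fun s hs => (mul_eq_zero.1 hs).resolve_left hF0⟩
  have hFR : algebraMap S R F = 0 := (hker F).2 dvd_rfl
  -- The resolution `0 → S → S → R → 0` by multiplication with `F`.
  have hRd : HasProjectiveDimensionLT (ModuleCat.of S R) 2 := by
    have hX : Function.Injective (LinearMap.mulLeft S F) := fun a b h =>
      mul_left_cancel₀ hF0 h
    have hS : Function.Exact (LinearMap.mulLeft S F) (Algebra.linearMap S R) := fun s => by
      rw [Algebra.linearMap_apply, hker]
      exact ⟨fun ⟨c, h⟩ => ⟨c, h.symm⟩, fun ⟨c, h⟩ => ⟨c, h.symm⟩⟩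
    obtain ⟨w, h⟩ := shortExact_of_exact _ (Algebra.linearMap S R) hX hR hS
    have : Projective (ModuleCat.of S S) := (IsProjective.iff_projective S).1 inferInstance
    exact (h w).hasProjectiveDimensionLT_X₃ 1 inferInstance inferInstance
  have hRn (n : ℕ) : HasProjectiveDimensionLT (ModuleCat.of S (Fin n → R)) 2 := by
    induction n with
    | zero =>
      have : Projective (ModuleCat.of S (Fin 0 → R)) :=
        (IsProjective.iff_projective _).1 inferInstance
      exact hasProjectiveDimensionLT_of_ge _ 1 2 (by simp)
    | succ n ih =>
      let i : R →ₗ[S] (Fin (n + 1) → R) := LinearMap.single S (fun _ => R) 0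
      let p : (Fin (n + 1) → R) →ₗ[S] (Fin n → R) := LinearMap.funLeft S R Fin.succ
      obtain ⟨w, h⟩ := shortExact_of_exact i p
        (Pi.single_injective (M := fun _ : Fin (n + 1) => R) 0)
        (LinearMap.funLeft_surjective_of_injective _ _ _ (Fin.succ_injective n)) (fun v => by
          constructor
          · intro hv
            refine ⟨v 0, funext fun j => ?_⟩
            cases j using Fin.cases with
            | zero => simp [i]
            | succ j => simpa [i, p] using (congrFun hv j).symm
          · rintro ⟨r, rfl⟩
            ext j
            simp [i, p])
      exact (h w).hasProjectiveDimensionLT_X₂ 2 hRd ih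
  induction d with
  | zero =>
    intro N N' _ _ _ _ _ _ _ q hq hN
    obtain ⟨m, z, hz⟩ := exists_linearCombination_surjective R N
    have hcompat (v : Fin m → S) : Fintype.linearCombination R z (algebraMap S R ∘ v) =
        Fintype.linearCombination S z v := by
      simp [Fintype.linearCombination_apply]
    have hzS : Function.Surjective (Fintype.linearCombination S z) := fun n => by
      obtain ⟨v, rfl⟩ := hz n
      obtain ⟨v, rfl⟩ := hφS.lift_fun v
      exact ⟨v, (hcompat v).symm⟩
    obtain ⟨A, B, hAB, hBA, hex⟩ := exists_matrixFactorization_of_projectiveDimension_le_one hF0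
      (fun n => by rw [← algebraMap_smul R F n, hFR, zero_smul]) hN z hzS
    have hexR : Function.Exact (matAct R (A.map (algebraMap S R)))
        (Fintype.linearCombination R z) := fun v => by
      obtain ⟨v, rfl⟩ := hφS.lift_fun v
      rw [hcompat]
      constructor
      · intro h
        obtain ⟨w, rfl⟩ := (hex v).1 h
        exact ⟨_, matAct_map_apply _ _ _⟩
      · rintro ⟨w, hw⟩
        obtain ⟨w, rfl⟩ := hφS.lift_fun w
        rw [matAct_map_apply] at hw
        rw [← hcompat, ← hw, hcompat]
        exact (hex _).2 ⟨w, rfl⟩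
    -- A relation among the reduced generators lifts to a relation over `R` after subtracting a
    -- multiple of `t`, as for syzygies.
    have hexR' : Function.Exact (matAct R' ((A.map (algebraMap S R)).map φ))
        (Fintype.linearCombination R' (q ∘ z)) := fun v => by
      obtain ⟨v, rfl⟩ := hφ.lift_fun v
      rw [← map_linearCombination, hq.eq_zero_iff]
      have hφt : φ t = 0 := (hφ.eq_zero_iff t).2 dvd_rfl
      constructor
      · rintro ⟨n, hn⟩
        obtain ⟨u, rfl⟩ := hz n
        rw [← map_smul, ← sub_eq_zero, ← map_sub] at hn
        obtain ⟨w, hw⟩ := (hexR _).1 hn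
        refine ⟨φ ∘ w, ?_⟩
        rw [matAct_map_apply, hw]
        ext i
        simp [hφt]
      · rintro ⟨w, hw⟩
        obtain ⟨w, rfl⟩ := hφ.lift_fun w
        rw [matAct_map_apply] at hw
        rw [← hq.eq_zero_iff, map_linearCombination, ← hw, ← map_linearCombination,
          (hexR _).2 ⟨w, rfl⟩, map_zero]
    have hmap (C : Matrix (Fin m) (Fin m) S) : (C.map (algebraMap S R)).map φ =
        (C.map ψ).map (algebraMap S' R') := by
      ext i j
      exact RingHom.congr_fun hcomm (C i j)
    have hmul {C D : Matrix (Fin m) (Fin m) S} (h : C * D = Matrix.scalar (Fin m) F) :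
        C.map ψ * D.map ψ = Matrix.scalar (Fin m) (ψ F) := by
      rw [← Matrix.map_mul, h]
      simp [Matrix.diagonal_map]
    refine ⟨0, m, A, B, hAB, hBA, ?_, ?_⟩
    · exact IsTorTail.of_coker (exact_of_matrixFactorization hφS.regular hR hker hBA hAB)
        (exact_of_matrixFactorization hφS.regular hR hker hAB hBA) _ hz hexR
    · have hreg : ∀ s, ψ F * s = 0 → s = 0 := fun s hs => (mul_eq_zero.1 hs).resolve_left hF
      refine IsTorTail.of_coker ?_ ?_ _ (hq.linearCombination_surjective z hz) hexR'
      · rw [hmap, hmap]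
        exact exact_of_matrixFactorization hreg hR' hker' (hmul hBA) (hmul hAB)
      · rw [hmap, hmap]
        exact exact_of_matrixFactorization hreg hR' hker' (hmul hAB) (hmul hBA)
  | succ d ih =>
    intro N N' _ _ _ _ _ _ _ q hq hN
    obtain ⟨m, z, hz⟩ := exists_linearCombination_surjective R N
    have : IsNoetherianRing R := isNoetherianRing_of_surjective S R (algebraMap S R) hR
    -- The middle term `Rᵐ` has dimension at most one over `S`, which is within the bound `d + 1`
    -- claimed for the syzygy.
    have hK : HasProjectiveDimensionLT
        (ModuleCat.of S (LinearMap.ker (Fintype.linearCombination R z))) (d + 2) := by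
      obtain ⟨w, h⟩ := shortExact_of_exact
        ((LinearMap.ker (Fintype.linearCombination R z)).subtype.restrictScalars S)
        ((Fintype.linearCombination R z).restrictScalars S) (Submodule.injective_subtype _) hz
        (LinearMap.exact_subtype_ker_map (Fintype.linearCombination R z))
      have := hRn m
      exact (h w).hasProjectiveDimensionLT_X₁ (d + 2)
        (hasProjectiveDimensionLT_of_ge _ 2 (d + 2) (by simp)) hN
    obtain ⟨k, m, A, B, hAB, hBA, h₁, h₂⟩ := ih (hq.ker hφ z hz) hK
    exact ⟨k + 1, m, A, B, hAB, hBA, IsTorTail.of_ker z hz h₁,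
      IsTorTail.of_ker _ (hq.linearCombination_surjective z hz) h₂⟩

end Main

/-! ### The homology of the special fibre -/

section Length

open LinearMap

lemma length_eq_of_bijective {R R' : Type*} [CommRing R] [CommRing R'] {φ : R →+* R'}
    [RingHomSurjective φ] {M M' : Type*} [AddCommGroup M] [Module R M] [AddCommGroup M']
    [Module R' M'] (f : M →ₛₗ[φ] M') (hf : Function.Bijective f) :
    Module.length R M = Module.length R' M' := by
  rw [Module.length, Module.length, WithBot.unbot_inj,
    Order.krullDim_eq_of_orderIso (Submodule.orderIsoMapComapOfBijective f hf)]

/-- `T / rT`. -/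
abbrev SMulCoker {R : Type*} [CommRing R] (r : R) (T : Type*) [AddCommGroup T] [Module R T] :
    Type _ := T ⧸ range (lsmul R T r)

/-- The `r`-torsion of `T`. -/
abbrev SMulKer {R : Type*} [CommRing R] (r : R) (T : Type*) [AddCommGroup T] [Module R T] :
    Submodule R T := ker (lsmul R T r)

variable {R R' : Type*} [CommRing R] [CommRing R'] {φ : R →+* R'} {t : R}
    {M M' : Type*} [AddCommGroup M] [Module R M] [AddCommGroup M'] [Module R' M']
    {q : M →ₛₗ[φ] M'} {ι : Type*} [Fintype ι]

lemma map_matAct (q : M →ₛₗ[φ] M') (A : Matrix ι ι R) (v : ι → M) :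
    q ∘ matAct M A v = matAct M' (A.map φ) (q ∘ v) := by
  ext i
  simp [matAct_apply]

lemma matAct_matAct_eq_zero {A B : Matrix ι ι R} (hAB : A * B = 0) (v : ι → M) :
    matAct M A (matAct M B v) = 0 := by
  rw [← matAct_mul_apply, hAB]
  ext i
  simp [matAct_apply]

/-- The long exact sequence of `0 → C → C → C' → 0`, with `C` the two-periodic complex on `Mⁿ` and
first map `t`, cut into `0 → H(A, B)/t → H'(A, B) → H(B, A)[t] → 0`. It is built by hand because
`H'` is a module over `R'` and the outer terms are modules over `R`. -/
theorem length_matHomology_fibre (hφ : IsRingFibre φ t) (hq : IsModuleFibre t q)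
    {A B : Matrix ι ι R} (hAB : A * B = 0) (hBA : B * A = 0) :
    Module.length R' (MatHomology M' (A.map φ) (B.map φ)) =
      Module.length R (SMulCoker t (MatHomology M A B)) +
        Module.length R (SMulKer t (MatHomology M B A)) := by
  have hs : RingHomSurjective φ := ⟨hφ.surjective⟩
  have hφt : φ t = 0 := (hφ.eq_zero_iff t).2 dvd_rfl
  have hreg (v w : ι → M) (h : t • v = t • w) : v = w := by
    ext i
    rw [← sub_eq_zero]
    exact hq.regular _ (by rw [smul_sub, sub_eq_zero]; exact congrFun h i)
  have hqt (v : ι → M) : q ∘ (t • v) = 0 := by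
    ext i
    simp [hφt]
  have hlift (v' : ι → M') : ∃ v : ι → M, q ∘ v = v' := by
    choose g hg using hq.surjective
    exact ⟨g ∘ v', funext fun i => hg _⟩
  have hzero (v : ι → M) (h : q ∘ v = 0) : ∃ w, v = t • w := by
    have : ∀ i, ∃ w, v i = t • w := fun i => (hq.eq_zero_iff _).1 (congrFun h i)
    choose w hw using this
    exact ⟨w, funext hw⟩
  -- `X` consists of the lifts of cycles of the fibre. On it `δ v = t⁻¹ A v` is well defined by
  -- regularity of `t`, and induces the connecting map.
  let X : Submodule R (ι → M) := (range (lsmul R (ι → M) t)).comap (matAct M A)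
  have hX (v : X) : ∃ w, matAct M A v = t • w := by
    obtain ⟨w, hw⟩ := v.2
    exact ⟨w, hw.symm⟩
  choose δ₀ hδ₀ using hX
  have hAδ (v : X) : matAct M B (δ₀ v) = 0 := by
    apply hreg
    rw [← map_smul, ← hδ₀, matAct_matAct_eq_zero hBA, smul_zero]
  let δ : X →ₗ[R] ker (matAct M B) :=
    { toFun := fun v => ⟨δ₀ v, hAδ v⟩
      map_add' := fun v w => by
        refine Subtype.ext (hreg _ _ ?_)
        change t • δ₀ (v + w) = t • (δ₀ v + δ₀ w)
        rw [smul_add, ← hδ₀, ← hδ₀, ← hδ₀]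
        simp
      map_smul' := fun c v => by
        refine Subtype.ext (hreg _ _ ?_)
        change t • δ₀ (c • v) = t • c • δ₀ v
        rw [smul_comm, ← hδ₀, ← hδ₀]
        simp }
  have hδ (v : X) : matAct M A v = t • (δ v : ι → M) := hδ₀ v
  -- the semilinear surjection onto the homology of the fibre
  let σ₀ : X →ₛₗ[φ] ker (matAct M' (A.map φ)) :=
    { toFun := fun v => ⟨q ∘ (v : ι → M), by
        rw [LinearMap.mem_ker, ← map_matAct, hδ, hqt]⟩
      map_add' := fun v w => by ext i; simp
      map_smul' := fun c v => by ext i; simp }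
  let σ : X →ₛₗ[φ] MatHomology M' (A.map φ) (B.map φ) := (Submodule.mkQ _).comp σ₀
  have hσ : Function.Surjective σ := by
    refine (Submodule.mkQ_surjective _).comp ?_
    rintro ⟨v', hv'⟩
    obtain ⟨v, rfl⟩ := hlift v'
    rw [LinearMap.mem_ker, ← map_matAct] at hv'
    obtain ⟨w, hw⟩ := hzero _ hv'
    exact ⟨⟨v, w, hw.symm⟩, rfl⟩
  have hσker (v : X) : σ v = 0 ↔ ∃ u w, (v : ι → M) = matAct M B u + t • w := by
    change Submodule.mkQ _ (σ₀ v) = 0 ↔ _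
    rw [Submodule.mkQ_apply, Submodule.Quotient.mk_eq_zero]
    change q ∘ (v : ι → M) ∈ range _ ↔ _
    constructor
    · rintro ⟨u, hu⟩
      obtain ⟨u, rfl⟩ := hlift u
      rw [← map_matAct] at hu
      obtain ⟨w, hw⟩ := hzero (v - matAct M B u) (by
        ext i
        have := congrFun hu i
        simp only [Function.comp_apply] at this
        simp [this])
      exact ⟨u, w, by rw [← hw]; abel⟩
    · rintro ⟨u, w, h⟩
      refine ⟨q ∘ u, ?_⟩
      rw [← map_matAct, h]
      ext i
      simp [hφt]
  have hkerδ (v : X) (h : σ v = 0) : ∃ w, (δ v : ι → M) = matAct M A w := by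
    obtain ⟨u, w, h⟩ := (hσker v).1 h
    refine ⟨w, hreg _ _ ?_⟩
    rw [← hδ, h, map_add, matAct_matAct_eq_zero hAB, map_smul, zero_add]
  -- `Y` is the fibre homology regarded as an `R`-module; `p` is the connecting map and `j` the
  -- reduction of cycles.
  let Y := X ⧸ ker σ
  let p₀ : X →ₗ[R] MatHomology M B A := (Submodule.mkQ _) ∘ₗ δ
  have hp₀ (v : X) : p₀ v = 0 ↔ ∃ w, (δ v : ι → M) = matAct M A w := by
    change Submodule.mkQ _ (δ v) = 0 ↔ _
    rw [Submodule.mkQ_apply, Submodule.Quotient.mk_eq_zero]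
    exact ⟨fun ⟨w, hw⟩ => ⟨w, hw.symm⟩, fun ⟨w, hw⟩ => ⟨w, hw.symm⟩⟩
  have hp₀t (v : X) : p₀ v ∈ SMulKer t (MatHomology M B A) := by
    rw [LinearMap.mem_ker, lsmul_apply, LinearMap.comp_apply, ← map_smul, Submodule.mkQ_apply, Submodule.Quotient.mk_eq_zero]
    exact ⟨v, hδ v⟩
  let p : Y →ₗ[R] SMulKer t (MatHomology M B A) :=
    (ker σ).liftQ (p₀.codRestrict _ hp₀t) fun v hv => Subtype.ext ((hp₀ v).2 (hkerδ v hv))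
  have hpmk (v : X) : p (Submodule.mkQ _ v) = ⟨p₀ v, hp₀t v⟩ := rfl
  have hp : Function.Surjective p := by
    rintro ⟨y, hy⟩
    obtain ⟨⟨w, hw⟩, rfl⟩ := Submodule.mkQ_surjective _ y
    rw [LinearMap.mem_ker, lsmul_apply, ← map_smul, Submodule.mkQ_apply, Submodule.Quotient.mk_eq_zero] at hy
    obtain ⟨v, hv⟩ := hy
    refine ⟨Submodule.mkQ _ ⟨v, w, hv.symm⟩, Subtype.ext ?_⟩
    rw [hpmk]
    refine congrArg (Submodule.mkQ _) (Subtype.ext (hreg _ _ ?_))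
    rw [← hδ]
    exact hv
  let j : ker (matAct M A) →ₗ[R] Y := Submodule.mkQ _ ∘ₗ
    Submodule.inclusion (fun v hv => ⟨0, by
      rw [LinearMap.mem_ker] at hv
      rw [hv, map_zero]⟩ : ker (matAct M A) ≤ X)
  have hjp : range j = ker p := by
    ext y
    obtain ⟨v, rfl⟩ := Submodule.mkQ_surjective _ y
    rw [LinearMap.mem_ker, hpmk, Subtype.ext_iff]
    change _ ↔ p₀ v = 0
    rw [hp₀]
    constructor
    · rintro ⟨u, hu⟩
      have h1 : σ (Submodule.inclusion _ u - v) = 0 := (Submodule.Quotient.eq _).1 hu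
      obtain ⟨w, hw⟩ := hkerδ _ h1
      refine ⟨- w, ?_⟩
      have h2 : (δ (Submodule.inclusion (fun v hv => ⟨0, by
          rw [LinearMap.mem_ker] at hv
          rw [hv, map_zero]⟩ : ker (matAct M A) ≤ X) u) : ι → M) = 0 := by
        apply hreg
        rw [← hδ, smul_zero]
        exact u.2
      rw [map_sub, Submodule.coe_sub, h2, zero_sub] at hw
      rw [map_neg, ← hw, neg_neg]
    · rintro ⟨w, hw⟩
      -- If `δ v = A w`, then `v - t w` is a genuine cycle with the same reduction as `v`.
      refine ⟨⟨v - t • w, by rw [LinearMap.mem_ker, map_sub, hδ, hw, map_smul, sub_self]⟩, ?_⟩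
      refine (Submodule.Quotient.eq _).2 ?_
      change σ _ = 0
      rw [hσker]
      refine ⟨0, - w, ?_⟩
      change (v - t • w : ι → M) - v = _
      simp
  let s : ker (matAct M A) →ₗ[R] SMulCoker t (MatHomology M A B) :=
    Submodule.mkQ _ ∘ₗ Submodule.mkQ _
  have hs : Function.Surjective s :=
    (Submodule.mkQ_surjective _).comp (Submodule.mkQ_surjective _)
  -- A cycle `v` reduces to a boundary exactly when `v = B u + t w`; then `w` is itself a cycle, so
  -- the class of `v` lies in `t H(A, B)`.
  have hsj : ker s = ker j := by
    ext v
    rw [LinearMap.mem_ker, LinearMap.mem_ker]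
    change Submodule.mkQ _ (Submodule.mkQ _ v) = 0 ↔ Submodule.mkQ _ _ = 0
    rw [Submodule.mkQ_apply, Submodule.Quotient.mk_eq_zero, Submodule.mkQ_apply _ (_ : X),
      Submodule.Quotient.mk_eq_zero]
    change _ ↔ σ _ = 0
    rw [hσker]
    constructor
    · rintro ⟨y, hy⟩
      obtain ⟨w, rfl⟩ := Submodule.mkQ_surjective _ y
      rw [lsmul_apply, ← map_smul, Submodule.mkQ_apply, Submodule.mkQ_apply, eq_comm,
        Submodule.Quotient.eq] at hy
      obtain ⟨u, hu⟩ := hy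
      refine ⟨u, w, ?_⟩
      rw [hu]
      change (v : ι → M) = (v - t • w : ι → M) + t • w
      abel
    · rintro ⟨u, w, h⟩
      have hw : matAct M A w = 0 := by
        apply hreg
        have h1 : matAct M A v = 0 := v.2
        have h2 : (v : ι → M) = matAct M B u + t • w := h
        rw [h2, map_add, matAct_matAct_eq_zero hAB, zero_add, map_smul] at h1
        rw [h1, smul_zero]
      refine ⟨Submodule.mkQ _ ⟨w, hw⟩, ?_⟩
      rw [lsmul_apply, ← map_smul, Submodule.mkQ_apply, Submodule.mkQ_apply, eq_comm,
        Submodule.Quotient.eq]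
      have h2 : (v : ι → M) = matAct M B u + t • w := h
      exact ⟨u, by simp [h2]⟩
  have e₁ : Module.length R Y = Module.length R' (MatHomology M' (A.map φ) (B.map φ)) := by
    refine length_eq_of_bijective ((ker σ).liftQ σ le_rfl) ⟨?_, ?_⟩
    · rw [← ker_eq_bot]
      exact Submodule.ker_liftQ_eq_bot' _ _ rfl
    · rw [← range_eq_top, Submodule.range_liftQ, range_eq_top]
      exact hσ
  have e₂ : Module.length R (ker p) = Module.length R (SMulCoker t (MatHomology M A B)) := by
    rw [← hjp, ← (quotKerEquivRange j).length_eq,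
      ← (quotKerEquivOfSurjective s hs).length_eq, hsj]
  rw [← e₁, ← e₂]
  exact Module.length_eq_add_of_exact (ker p).subtype p (Submodule.injective_subtype _) hp
    (exact_subtype_ker_map p)

end Length

/-! ### Rank over a discrete valuation ring -/

section Rank

open LinearMap

variable {A : Type*} [CommRing A]

lemma length_smulCoker_congr (t : A) {X Y : Type*} [AddCommGroup X] [Module A X] [AddCommGroup Y]
    [Module A Y] (e : X ≃ₗ[A] Y) :
    Module.length A (SMulCoker t X) = Module.length A (SMulCoker t Y) := by
  refine (Submodule.Quotient.equiv _ _ e ?_).length_eq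
  ext y
  constructor
  · rintro ⟨_, ⟨x, rfl⟩, rfl⟩
    exact ⟨e x, by simp⟩
  · rintro ⟨y, rfl⟩
    exact ⟨t • e.symm y, ⟨e.symm y, rfl⟩, by simp⟩

lemma length_smulKer_congr (t : A) {X Y : Type*} [AddCommGroup X] [Module A X] [AddCommGroup Y]
    [Module A Y] (e : X ≃ₗ[A] Y) :
    Module.length A (SMulKer t X) = Module.length A (SMulKer t Y) := by
  refine (e.ofSubmodules _ _ ?_).length_eq
  ext y
  constructor
  · rintro ⟨x, hx, rfl⟩
    have hx : t • x = 0 := hx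
    change t • e x = 0
    rw [← map_smul, hx, map_zero]
  · intro hy
    have hy : t • y = 0 := hy
    refine ⟨e.symm y, ?_, by simp⟩
    change t • e.symm y = 0
    rw [← map_smul, hy, map_zero]

lemma length_smulCoker_prod (t : A) (X Y : Type*) [AddCommGroup X] [Module A X] [AddCommGroup Y]
    [Module A Y] :
    Module.length A (SMulCoker t (X × Y)) =
      Module.length A (SMulCoker t X) + Module.length A (SMulCoker t Y) := by
  let f := (range (lsmul A X t)).mkQ.prodMap (range (lsmul A Y t)).mkQ
  have hf : Function.Surjective f :=
    Function.Surjective.prodMap (Submodule.mkQ_surjective _) (Submodule.mkQ_surjective _)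
  rw [← Module.length_prod, ← (f.quotKerEquivOfSurjective hf).length_eq]
  refine (Submodule.quotEquivOfEq _ _ ?_).length_eq
  rw [ker_prodMap, Submodule.ker_mkQ, Submodule.ker_mkQ, ← range_prodMap]
  rfl

lemma length_smulKer_prod (t : A) (X Y : Type*) [AddCommGroup X] [Module A X] [AddCommGroup Y]
    [Module A Y] :
    Module.length A (SMulKer t (X × Y)) =
      Module.length A (SMulKer t X) + Module.length A (SMulKer t Y) := by
  rw [← Module.length_prod]
  have h (z : SMulKer t (X × Y)) : t • z.1.1 = 0 ∧ t • z.1.2 = 0 := Prod.mk.inj z.2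
  exact LinearEquiv.length_eq
    { toFun := fun z => (⟨z.1.1, (h z).1⟩, ⟨z.1.2, (h z).2⟩)
      map_add' := fun _ _ => rfl
      map_smul' := fun _ _ => rfl
      invFun := fun z => ⟨(z.1.1, z.2.1), Prod.ext z.1.2 z.2.2⟩
      left_inv := fun _ => rfl
      right_inv := fun _ => rfl }

/-- Both lengths are complementary to that of `tT`, which is finite and cancels. -/
lemma length_smulCoker_eq_of_isFiniteLength (t : A) (T : Type*) [AddCommGroup T] [Module A T]
    (hT : Module.length A T ≠ ⊤) :
    Module.length A (SMulCoker t T) = Module.length A (SMulKer t T) := by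
  have h₁ := Module.length_eq_add_of_exact (SMulKer t T).subtype (lsmul A T t).rangeRestrict
    (Submodule.injective_subtype _) (surjective_rangeRestrict _) (fun x => by
      rw [← LinearMap.mem_ker, ker_rangeRestrict]
      simp)
  have h₂ := Module.length_eq_add_of_exact (range (lsmul A T t)).subtype
    (range (lsmul A T t)).mkQ (Submodule.injective_subtype _) (Submodule.mkQ_surjective _)
    (LinearMap.exact_subtype_mkQ _)
  have h₃ : Module.length A (range (lsmul A T t)) ≠ ⊤ := by
    intro h
    rw [h, top_add] at h₂
    exact hT h₂
  rw [h₁, add_comm] at h₂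
  exact (WithTop.add_left_cancel h₃ h₂).symm

/-- Over a discrete valuation ring with uniformizer `t`, the rank of a finitely generated module `T`
is the length of `T / tT` minus the length of the `t`-torsion of `T`. -/
theorem length_smulCoker_eq [IsDomain A] [IsDiscreteValuationRing A] {t : A} (ht : Irreducible t)
    (T : Type*) [AddCommGroup T] [Module A T] [Module.Finite A T] :
    Module.length A (SMulCoker t T) = Module.finrank A T + Module.length A (SMulKer t T) := by
  -- Structure theorem: the torsion summand has finite length and contributes equally to both sides,
  -- while each free summand contributes one to the cokernel and nothing to the kernel.
  obtain ⟨n, ι, _, p, hp, e, ⟨E⟩⟩ := Module.equiv_free_prod_directSum A T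
  classical
  let τ := DirectSum ι fun i => A ⧸ Ideal.span {p i ^ e i}
  let E' : T ≃ₗ[A] (Fin n → A) × τ :=
    E.trans ((Finsupp.linearEquivFunOnFinite A A (Fin n)).prodCongr (LinearEquiv.refl A τ))
  have hτ : Module.length A τ ≠ ⊤ := by
    rw [(DirectSum.linearEquivFunOnFintype A ι fun i => A ⧸ Ideal.span {p i ^ e i}).length_eq,
      Module.length_pi_of_fintype]
    refine WithTop.sum_ne_top.2 fun i _ => ?_
    refine Module.length_ne_top_iff.2 ?_
    exact isFiniteLength_quotient_span_singleton A
      (mem_nonZeroDivisors_of_ne_zero (pow_ne_zero _ (hp i).ne_zero))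
  have hrank : Module.finrank A T = n := by
    have hle : range (inr A (Fin n → A) τ) ≤ Submodule.torsion A ((Fin n → A) × τ) := by
      rintro _ ⟨x, rfl⟩
      refine (Submodule.mem_torsion_iff _).2 ⟨⟨∏ i, p i ^ e i, mem_nonZeroDivisors_of_ne_zero
        (Finset.prod_ne_zero_iff.2 fun i _ => pow_ne_zero _ (hp i).ne_zero)⟩, ?_⟩
      have hx : (∏ i, p i ^ e i) • x = 0 := by
        refine DFinsupp.ext fun i => ?_
        obtain ⟨y, hy⟩ := Submodule.mkQ_surjective _ (x i)
        change (∏ i, p i ^ e i) • x i = 0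
        rw [← hy, ← map_smul, Submodule.mkQ_apply, Submodule.Quotient.mk_eq_zero,
          Ideal.mem_span_singleton]
        exact (Finset.dvd_prod_of_mem _ (Finset.mem_univ i)).mul_right y
      change (∏ i, p i ^ e i) • inr A (Fin n → A) τ x = 0
      rw [← map_smul, hx, map_zero]
    rw [E'.finrank_eq, ← finrank_quotient_eq_of_le_torsion hle,
      ((Submodule.quotEquivOfEq _ _ (range_inr A (Fin n → A) τ)).trans
        (quotKerEquivOfSurjective _ fst_surjective)).finrank_eq, Module.finrank_fin_fun]
  have hF₁ : Module.length A (SMulCoker t (Fin n → A)) = n := by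
    let f : (Fin n → A) →ₗ[A] (Fin n → A ⧸ Ideal.span {t}) := LinearMap.compLeft (Ideal.span {t}).mkQ (Fin n)
    have hf : Function.Surjective f :=
      fun v => by
        choose g hg using (Ideal.span {t}).mkQ_surjective
        exact ⟨g ∘ v, funext fun i => hg _⟩
    have hker : range (lsmul A (Fin n → A) t) = ker f := by
      ext v
      have hv : v ∈ ker f ↔ ∀ i, t ∣ v i := by
        rw [LinearMap.mem_ker, funext_iff]
        refine forall_congr' fun i => ?_
        rw [← Ideal.mem_span_singleton]
        exact Submodule.Quotient.mk_eq_zero _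
      rw [hv]
      constructor
      · rintro ⟨w, rfl⟩ i
        exact ⟨w i, rfl⟩
      · intro h
        choose w hw using h
        exact ⟨w, funext fun i => (hw i).symm⟩
    have hsimple : IsSimpleModule A (A ⧸ Ideal.span {t}) := isSimpleModule_iff_isCoatom.2
      (PrincipalIdealRing.isMaximal_of_irreducible ht).out
    rw [(Submodule.quotEquivOfEq _ _ hker).length_eq, (f.quotKerEquivOfSurjective hf).length_eq,
      Module.length_pi, Module.length_eq_one]
    simp
  have hF₂ : Module.length A (SMulKer t (Fin n → A)) = 0 := by
    rw [Module.length_eq_zero_iff]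
    refine ⟨fun a b => ?_⟩
    have h (a : SMulKer t (Fin n → A)) : a = 0 := by
      have := a.2
      rw [LinearMap.mem_ker, lsmul_apply] at this
      exact Subtype.ext ((smul_eq_zero.1 this).resolve_left ht.ne_zero)
    rw [h a, h b]
  rw [length_smulCoker_congr t E', length_smulKer_congr t E', length_smulCoker_prod,
    length_smulKer_prod, length_smulCoker_eq_of_isFiniteLength t τ hτ, hrank, hF₁, hF₂, zero_add]

end Rank

/-! ### Weighted norms on power series -/

section Weight

open MvPowerSeries
open scoped ENNReal NNReal

variable {σ : Type*}

/-- The weight `∏ p_i ^ d_i` of an exponent `d`. -/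
def expWeight (p : σ → ℕ) (d : σ →₀ ℕ) : ℕ := d.prod fun i k => p i ^ k

lemma expWeight_add (p : σ → ℕ) (d e : σ →₀ ℕ) :
    expWeight p (d + e) = expWeight p d * expWeight p e := by
  classical
  exact Finsupp.prod_add_index' (fun _ => pow_zero _) fun _ _ _ => pow_add _ _ _

lemma expWeight_pos {p : σ → ℕ} (hp : ∀ i, 2 ≤ p i) (d : σ →₀ ℕ) : 0 < expWeight p d :=
  Finset.prod_pos fun i _ => pow_pos (by have := hp i; lia) _

/-- The absolute value of the monomial with exponent `d` on the polydisc of radii `p_i ^ (-K)`. -/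
def monoRadius (p : σ → ℕ) (K : ℕ) (d : σ →₀ ℕ) : ℝ≥0 := ((expWeight p d : ℝ≥0)⁻¹) ^ K

lemma monoRadius_add (p : σ → ℕ) (K : ℕ) (d e : σ →₀ ℕ) :
    monoRadius p K (d + e) = monoRadius p K d * monoRadius p K e := by
  simp [monoRadius, expWeight_add, mul_pow, mul_comm]

lemma monoRadius_eq_prod (p : σ → ℕ) (K : ℕ) (d : σ →₀ ℕ) :
    monoRadius p K d = d.prod fun i k => (((p i : ℝ≥0)⁻¹) ^ K) ^ k := by
  rw [monoRadius, expWeight, Finsupp.prod, Finsupp.prod, Nat.cast_prod, ← Finset.prod_inv_distrib,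
    ← Finset.prod_pow]
  refine Finset.prod_congr rfl fun i _ => ?_
  rw [Nat.cast_pow, ← inv_pow, ← pow_mul, ← pow_mul, mul_comm]

lemma monoRadius_pos {p : σ → ℕ} (hp : ∀ i, 2 ≤ p i) (K : ℕ) (d : σ →₀ ℕ) :
    0 < monoRadius p K d := by
  have := expWeight_pos hp d
  unfold monoRadius
  positivity

lemma monoRadius_anti {p : σ → ℕ} (hp : ∀ i, 2 ≤ p i) {K L : ℕ} (h : K ≤ L) (d : σ →₀ ℕ) :
    monoRadius p L d ≤ monoRadius p K d := by
  refine pow_le_pow_of_le_one (by positivity) ?_ h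
  exact inv_le_one_of_one_le₀ (by exact_mod_cast expWeight_pos hp d)

/-- The `ℓ¹`-norm of a power series on the polydisc of radii `p_i ^ (-K)`. -/
def wnorm (p : σ → ℕ) (K : ℕ) (f : MvPowerSeries σ ℂ) : ℝ≥0∞ :=
  ∑' d, ‖coeff d f‖ₑ * monoRadius p K d

variable {p : σ → ℕ} {K : ℕ}

lemma wnorm_anti (hp : ∀ i, 2 ≤ p i) {K L : ℕ} (h : K ≤ L) (f : MvPowerSeries σ ℂ) :
    wnorm p L f ≤ wnorm p K f := by
  refine ENNReal.tsum_le_tsum fun d => ?_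
  have := monoRadius_anti hp h d
  gcongr

lemma wnorm_add_le (f g : MvPowerSeries σ ℂ) :
    wnorm p K (f + g) ≤ wnorm p K f + wnorm p K g := by
  rw [wnorm, wnorm, wnorm, ← ENNReal.tsum_add]
  refine ENNReal.tsum_le_tsum fun d => ?_
  rw [← add_mul, map_add]
  gcongr
  exact enorm_add_le _ _

lemma wnorm_zero : wnorm p K 0 = 0 := by simp [wnorm]

lemma wnorm_sum_le {J : Type*} (s : Finset J) (f : J → MvPowerSeries σ ℂ) :
    wnorm p K (∑ j ∈ s, f j) ≤ ∑ j ∈ s, wnorm p K (f j) := by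
  classical
  induction s using Finset.induction_on with
  | empty => simp [wnorm_zero]
  | insert j s hj ih =>
    rw [Finset.sum_insert hj, Finset.sum_insert hj]
    exact (wnorm_add_le _ _).trans (by gcongr)

lemma wnorm_mul_le (f g : MvPowerSeries σ ℂ) :
    wnorm p K (f * g) ≤ wnorm p K f * wnorm p K g := by
  classical
  have h1 : wnorm p K f * wnorm p K g = ∑' x : (σ →₀ ℕ) × (σ →₀ ℕ),
      (‖coeff x.1 f‖ₑ * monoRadius p K x.1) * (‖coeff x.2 g‖ₑ * monoRadius p K x.2) := by
    rw [ENNReal.tsum_prod (f := fun x y => (‖coeff x f‖ₑ * monoRadius p K x : ℝ≥0∞) *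
      (‖coeff y g‖ₑ * monoRadius p K y)), wnorm, ← ENNReal.tsum_mul_right]
    exact tsum_congr fun d => ENNReal.tsum_mul_left.symm
  rw [h1, ← (Finset.HasAntidiagonal.sigmaAntidiagonalEquivProd (A := σ →₀ ℕ)).tsum_eq, ENNReal.tsum_sigma']
  refine ENNReal.tsum_le_tsum fun d => ?_
  rw [tsum_fintype, coeff_mul, ← Finset.sum_coe_sort]
  refine (mul_le_mul_left (enorm_sum_le _ _) _).trans ?_
  rw [Finset.sum_mul]
  refine Finset.sum_le_sum fun x _ => ?_
  have hx : monoRadius p K d = monoRadius p K x.1.1 * monoRadius p K x.1.2 := by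
    rw [← monoRadius_add, Finset.HasAntidiagonal.mem_antidiagonal.1 x.2]
  rw [hx, enorm_mul, ENNReal.coe_mul]
  refine le_of_eq ?_
  simp only [Finset.HasAntidiagonal.sigmaAntidiagonalEquivProd_apply]
  ring

/-- The polydiscs of radii `p_i ^ (-K)` and those with equal radii are cofinal in each other. One
direction uses `p_i ≥ 2`, the other bounds every `p_i` by their product, which needs finitely many
variables. -/
lemma isConvergent_iff_wnorm [Finite σ] (hp : ∀ i, 2 ≤ p i) (f : MvPowerSeries σ ℂ) :
    IsConvergent f ↔ ∃ K, wnorm p K f ≠ ⊤ := by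
  have key (r : ℝ≥0) :
      (Summable fun d : σ →₀ ℕ => ‖coeff d f‖ * (r : ℝ) ^ d.degree) ↔
      ∑' d, ‖coeff d f‖ₑ * ((r ^ d.degree : ℝ≥0) : ℝ≥0∞) ≠ ⊤ := by
    have h : (fun d : σ →₀ ℕ => ‖coeff d f‖ₑ * ((r ^ d.degree : ℝ≥0) : ℝ≥0∞)) =
        fun d => ((‖coeff d f‖₊ * r ^ d.degree : ℝ≥0) : ℝ≥0∞) := by
      ext d
      simp [enorm_eq_nnnorm]
    rw [h, ENNReal.tsum_coe_ne_top_iff_summable, ← NNReal.summable_coe]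
    simp
  have hprod (c : ℝ≥0) (d : σ →₀ ℕ) : c ^ d.degree = d.prod fun _ k => c ^ k := by
    rw [Finsupp.degree_apply, Finsupp.prod, Finset.prod_pow_eq_pow_sum]
  constructor
  · rintro ⟨r, hr, h⟩
    lift r to ℝ≥0 using hr.le
    rw [key r] at h
    obtain ⟨K, hK⟩ := exists_pow_lt_of_lt_one hr (show (1 / 2 : ℝ) < 1 by norm_num)
    refine ⟨K, ne_top_of_le_ne_top h (ENNReal.tsum_le_tsum fun d => ?_)⟩
    have : monoRadius p K d ≤ r ^ d.degree := by
      rw [hprod, monoRadius_eq_prod]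
      refine Finset.prod_le_prod' fun i _ => ?_
      refine pow_le_pow_left' ?_ _
      refine le_trans (pow_le_pow_left' (b := 1 / 2) ?_ K) ?_
      · rw [one_div]
        gcongr
        exact_mod_cast hp i
      · rw [← NNReal.coe_le_coe]
        push_cast
        exact hK.le
    gcongr
  · rintro ⟨K, hK⟩
    have := Fintype.ofFinite σ
    let c : ℕ := ∏ i, p i
    have hc (i : σ) : p i ≤ c := by
      refine Nat.le_of_dvd (Finset.prod_pos fun j _ => ?_)
        (Finset.dvd_prod_of_mem p (Finset.mem_univ i))
      have := hp j
      lia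
    have hc0 : 0 < c := Finset.prod_pos fun j _ => by
      have := hp j
      lia
    refine ⟨(((c : ℝ≥0)⁻¹ ^ K : ℝ≥0) : ℝ), by positivity, ?_⟩
    rw [key]
    refine ne_top_of_le_ne_top hK (ENNReal.tsum_le_tsum fun d => ?_)
    have : ((c : ℝ≥0)⁻¹ ^ K) ^ d.degree ≤ monoRadius p K d := by
      rw [hprod, monoRadius_eq_prod]
      refine Finset.prod_le_prod' fun i _ => ?_
      refine pow_le_pow_left' (pow_le_pow_left' ?_ _) _
      have h0 := hp i
      gcongr
      exact hc i
    gcongr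

/-- Power series all of whose other monomials are of larger weight than `a` become small compared
to the monomial `a` on small polydiscs. -/
lemma eventually_wnorm_le (hp : ∀ i, 2 ≤ p i) {f : MvPowerSeries σ ℂ} {K₀ : ℕ}
    (hf : wnorm p K₀ f ≠ ⊤) {a : σ →₀ ℕ}
    (hfa : ∀ d, coeff d f ≠ 0 → expWeight p a < expWeight p d) :
    ∀ᶠ K in atTop, wnorm p K f ≤ (1 / 2) * monoRadius p K a := by
  lift wnorm p K₀ f to ℝ≥0 using hf with C hC
  have ha := expWeight_pos hp a
  -- Weights are integers, so all monomials of `f` have weight at least `expWeight p a + 1`. Raising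
  -- `K` by one divides the monomial `a` by `expWeight p a` and the others by at least one more, so
  -- their ratio shrinks at least by the factor `θ < 1`.
  let θ : ℝ≥0 := expWeight p a / (expWeight p a + 1)
  have hθ : θ < 1 := by
    rw [div_lt_one (by positivity)]
    exact lt_add_one _
  have hbound (i : ℕ) : wnorm p (K₀ + i) f ≤ ((((expWeight p a : ℝ≥0) + 1)⁻¹ ^ i * C : ℝ≥0) : ℝ≥0∞) := by
    rw [ENNReal.coe_mul, hC, wnorm, wnorm, ← ENNReal.tsum_mul_left]
    refine ENNReal.tsum_le_tsum fun d => ?_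
    by_cases hd : coeff d f = 0
    · simp [hd]
    · have h1 : monoRadius p (K₀ + i) d ≤
          ((expWeight p a : ℝ≥0) + 1)⁻¹ ^ i * monoRadius p K₀ d := by
        rw [monoRadius, pow_add, mul_comm, monoRadius]
        gcongr
        exact_mod_cast hfa d hd
      calc _ ≤ ‖coeff d f‖ₑ * ((((expWeight p a : ℝ≥0) + 1)⁻¹ ^ i * monoRadius p K₀ d : ℝ≥0) :
            ℝ≥0∞) := by gcongr
        _ = _ := by push_cast; ring
  have hlim : Tendsto (fun i : ℕ => θ ^ i * ((expWeight p a : ℝ≥0) ^ K₀ * C)) atTop (nhds 0) := by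
    have := (NNReal.tendsto_pow_atTop_nhds_zero_of_lt_one hθ).mul_const
      ((expWeight p a : ℝ≥0) ^ K₀ * C)
    rwa [zero_mul] at this
  obtain ⟨N, hN⟩ := eventually_atTop.1 (hlim.eventually (ge_mem_nhds (show (0 : ℝ≥0) < 1 / 2 by
    norm_num)))
  filter_upwards [eventually_ge_atTop (K₀ + N)] with K hK
  obtain ⟨i, rfl⟩ := Nat.exists_eq_add_of_le (show K₀ ≤ K by lia)
  refine (hbound i).trans ?_
  have h2 := hN i (by lia)
  have h3 : ((expWeight p a : ℝ≥0) + 1)⁻¹ ^ i * C ≤ 1 / 2 * monoRadius p (K₀ + i) a := by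
    have h4 : θ ^ i * ((expWeight p a : ℝ≥0) ^ K₀ * C) * monoRadius p (K₀ + i) a =
        ((expWeight p a : ℝ≥0) + 1)⁻¹ ^ i * C := by
      rw [monoRadius, pow_add]
      simp only [θ, div_pow, inv_pow]
      field_simp
    rw [← h4]
    gcongr
  calc _ ≤ ((1 / 2 * monoRadius p (K₀ + i) a : ℝ≥0) : ℝ≥0∞) := by gcongr
    _ = _ := by push_cast; rfl

end Weight

lemma ConvPS.toFormal_injective {σ : Type*} : Function.Injective (ConvPS.toFormal σ) :=
  Subtype.val_injective

lemma IsConvergent.monomial {σ : Type*} (a : σ →₀ ℕ) (c : ℂ) :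
    IsConvergent (MvPowerSeries.monomial a c) := by
  classical
  refine ⟨1, one_pos, summable_of_ne_finset_zero (s := {a}) fun d hd => ?_⟩
  rw [MvPowerSeries.coeff_monomial, if_neg (by simpa using hd), norm_zero, zero_mul]

/-! ### The division theorem -/

section Division

open MvPowerSeries
open scoped ENNReal NNReal Classical

variable {σ : Type*} {p : σ → ℕ} {K : ℕ} {J : Type*} [Fintype J] (a : J → σ →₀ ℕ)

/-- A choice of `j` with `a j ≤ d`. -/
def selectIndex (d : σ →₀ ℕ) : Option J :=
  if h : ∃ j, a j ≤ d then some h.choose else none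

variable {a} in
lemma le_of_selectIndex_eq_some {d : σ →₀ ℕ} {j : J} (h : selectIndex a d = some j) :
    a j ≤ d := by
  unfold selectIndex at h
  split_ifs at h with h'
  · rw [← Option.some.inj h]
    exact h'.choose_spec

variable {a} in
lemma not_le_of_selectIndex_eq_none {d : σ →₀ ℕ} (h : selectIndex a d = none) (j : J) :
    ¬ a j ≤ d := fun h' => by
  unfold selectIndex at h
  rw [dif_pos ⟨j, h'⟩] at h
  exact Option.some_ne_none _ h

/-- The part of a power series divisible by `x ^ a j`, divided by `x ^ a j`; only the exponents
`d` that select `j` are taken into account. -/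
def quotPart (j : J) : MvPowerSeries σ ℂ →ₗ[ℂ] MvPowerSeries σ ℂ where
  toFun f := fun e => if selectIndex a (e + a j) = some j then coeff (e + a j) f else 0
  map_add' f g := by
    funext e
    change (if selectIndex a (e + a j) = some j then coeff (e + a j) (f + g) else 0) =
      (if selectIndex a (e + a j) = some j then coeff (e + a j) f else 0) +
        (if selectIndex a (e + a j) = some j then coeff (e + a j) g else 0)
    split_ifs <;> simp
  map_smul' c f := by
    funext e
    change (if selectIndex a (e + a j) = some j then coeff (e + a j) (c • f) else 0) =
      c * (if selectIndex a (e + a j) = some j then coeff (e + a j) f else 0)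
    split_ifs <;> simp

/-- The part of a power series not divisible by any `x ^ a j`. -/
def remPart (f : MvPowerSeries σ ℂ) : MvPowerSeries σ ℂ :=
  fun d => if selectIndex a d = none then coeff d f else 0

lemma coeff_quotPart (j : J) (f : MvPowerSeries σ ℂ) (e : σ →₀ ℕ) :
    coeff e (quotPart a j f) =
      if selectIndex a (e + a j) = some j then coeff (e + a j) f else 0 := rfl

lemma coeff_remPart (f : MvPowerSeries σ ℂ) (d : σ →₀ ℕ) :
    coeff d (remPart a f) = if selectIndex a d = none then coeff d f else 0 := rfl

lemma eq_sum_quotPart_add_remPart (f : MvPowerSeries σ ℂ) :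
    f = ∑ j, quotPart a j f * monomial (a j) 1 + remPart a f := by
  ext d
  rw [map_add, map_sum, coeff_remPart]
  have h (j : J) : coeff d (quotPart a j f * monomial (a j) 1) =
      if selectIndex a d = some j then coeff d f else 0 := by
    rw [coeff_mul_monomial]
    by_cases hj : a j ≤ d
    · rw [if_pos hj, mul_one, coeff_quotPart, tsub_add_cancel_of_le hj]
    · rw [if_neg hj, if_neg fun h => hj (le_of_selectIndex_eq_some h)]
  rw [Finset.sum_congr rfl fun j _ => h j]
  cases hd : selectIndex a d with
  | none => simp
  | some i => simp

/-- Each exponent selects at most one `j`, so the terms on the left come from disjoint parts of `f`.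
-/
lemma sum_wnorm_quotPart_le (f : MvPowerSeries σ ℂ) :
    ∑ j, wnorm p K (quotPart a j f) * monoRadius p K (a j) ≤ wnorm p K f := by
  let φ (j : J) (d : σ →₀ ℕ) : ℝ≥0∞ :=
    if selectIndex a d = some j then ‖coeff d f‖ₑ * monoRadius p K d else 0
  have h1 (j : J) : wnorm p K (quotPart a j f) * monoRadius p K (a j) ≤ ∑' d, φ j d := by
    refine le_trans (le_of_eq ?_)
      (ENNReal.tsum_comp_le_tsum_of_injective (add_left_injective (a j)) (φ j))
    rw [wnorm, ← ENNReal.tsum_mul_right]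
    refine tsum_congr fun e => ?_
    simp only [φ, coeff_quotPart]
    split_ifs
    · rw [monoRadius_add, ENNReal.coe_mul, mul_assoc]
    · simp
  refine (Finset.sum_le_sum fun j _ => h1 j).trans ?_
  rw [← Summable.tsum_finsetSum fun _ _ => ENNReal.summable]
  refine ENNReal.tsum_le_tsum fun d => ?_
  cases hd : selectIndex a d with
  | none => simp [φ, hd]
  | some i => simp [φ, hd]

lemma wnorm_remPart_le (f : MvPowerSeries σ ℂ) : wnorm p K (remPart a f) ≤ wnorm p K f := by
  refine ENNReal.tsum_le_tsum fun d => ?_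
  rw [coeff_remPart]
  split_ifs
  · exact le_rfl
  · simp

/-- The operator `f ↦ ∑ Q_j(f) h_j`. -/
def reduceOp (h : J → MvPowerSeries σ ℂ) : Module.End ℂ (MvPowerSeries σ ℂ) :=
  ∑ j, LinearMap.mulRight ℂ (h j) ∘ₗ quotPart a j

lemma reduceOp_apply (h : J → MvPowerSeries σ ℂ) (f : MvPowerSeries σ ℂ) :
    reduceOp a h f = ∑ j, quotPart a j f * h j := by
  simp [reduceOp]

lemma wnorm_reduceOp_le {h : J → MvPowerSeries σ ℂ}
    (hh : ∀ j, wnorm p K (h j) ≤ (1 / 2) * monoRadius p K (a j)) (f : MvPowerSeries σ ℂ) :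
    wnorm p K (reduceOp a h f) ≤ (1 / 2) * wnorm p K f := by
  rw [reduceOp_apply]
  calc _ ≤ ∑ j, wnorm p K (quotPart a j f * h j) := wnorm_sum_le _ _
    _ ≤ ∑ j, wnorm p K (quotPart a j f) * ((1 / 2) * monoRadius p K (a j)) := by
      refine Finset.sum_le_sum fun j _ => (wnorm_mul_le _ _).trans ?_
      have := hh j
      gcongr
    _ = (1 / 2) * ∑ j, wnorm p K (quotPart a j f) * monoRadius p K (a j) := by
      rw [Finset.mul_sum]
      exact Finset.sum_congr rfl fun j _ => by ring
    _ ≤ _ := by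
      have := sum_wnorm_quotPart_le (p := p) (K := K) a f
      gcongr

/-- The operator replaces a factor `x ^ a j` by strictly heavier terms, so it raises the least
weight that occurs. -/
lemma coeff_reduceOp_eq_zero (hp : ∀ i, 2 ≤ p i) {h : J → MvPowerSeries σ ℂ}
    (hh : ∀ j d, coeff d (h j) ≠ 0 → expWeight p (a j) < expWeight p d)
    {f : MvPowerSeries σ ℂ} {d : σ →₀ ℕ}
    (hf : ∀ e, expWeight p e < expWeight p d → coeff e f = 0) :
    coeff d (reduceOp a h f) = 0 := by
  rw [reduceOp_apply, map_sum]
  refine Finset.sum_eq_zero fun j _ => ?_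
  rw [coeff_mul]
  refine Finset.sum_eq_zero fun x hx => ?_
  by_cases hx2 : coeff x.2 (h j) = 0
  · rw [hx2, mul_zero]
  · rw [coeff_quotPart, hf, ite_self, zero_mul]
    rw [← Finset.HasAntidiagonal.mem_antidiagonal.1 hx, expWeight_add, expWeight_add]
    exact Nat.mul_lt_mul_of_pos_left (hh j _ hx2) (expWeight_pos hp _)

lemma coeff_reduceOp_pow_eq_zero (hp : ∀ i, 2 ≤ p i) {h : J → MvPowerSeries σ ℂ}
    (hh : ∀ j d, coeff d (h j) ≠ 0 → expWeight p (a j) < expWeight p d)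
    (f : MvPowerSeries σ ℂ) (n : ℕ) : ∀ d : σ →₀ ℕ, expWeight p d ≤ n →
    coeff d ((reduceOp a h ^ n) f) = 0 := by
  induction n with
  | zero =>
    intro d hd
    have := expWeight_pos hp d
    lia
  | succ n ih =>
    intro d hd
    rw [pow_succ', Module.End.mul_apply]
    exact coeff_reduceOp_eq_zero a hp hh fun e he => ih e (by lia)

/-- The solution `G` of `G = g + ∑ Q_j(G) h_j`. -/
lemma exists_eq_add_reduceOp (hp : ∀ i, 2 ≤ p i) {h : J → MvPowerSeries σ ℂ}
    (hh : ∀ j d, coeff d (h j) ≠ 0 → expWeight p (a j) < expWeight p d)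
    (hK : ∀ j, wnorm p K (h j) ≤ (1 / 2) * monoRadius p K (a j)) (g : MvPowerSeries σ ℂ)
    (hg : wnorm p K g ≠ ⊤) :
    ∃ G, wnorm p K G ≠ ⊤ ∧ G = g + reduceOp a h G := by
  let T := reduceOp a h
  let s (n : ℕ) : MvPowerSeries σ ℂ := ∑ m ∈ Finset.range n, (T ^ m) g
  -- `G` is the Neumann series `∑ Tⁿ g`. It is a finite sum in each coefficient, since `Tⁿ g` has no
  -- terms of weight at most `n`.
  let G : MvPowerSeries σ ℂ := fun d => coeff d (s (expWeight p d + 1))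
  have hG (d : σ →₀ ℕ) : coeff d G = coeff d (s (expWeight p d + 1)) := rfl
  have hs (d : σ →₀ ℕ) (n : ℕ) (hn : expWeight p d < n) : coeff d (s n) = coeff d G := by
    induction n, hn using Nat.le_induction with
    | base => rfl
    | succ n hn ih =>
      rw [← ih]
      change coeff d (∑ m ∈ Finset.range (n + 1), (T ^ m) g) = _
      rw [Finset.sum_range_succ, map_add,
        coeff_reduceOp_pow_eq_zero a hp hh g n d (by lia), add_zero]
  refine ⟨G, ?_, ?_⟩
  · have hpow (n : ℕ) : wnorm p K ((T ^ n) g) ≤ (1 / 2) ^ n * wnorm p K g := by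
      induction n with
      | zero => simp
      | succ n ih =>
        rw [pow_succ', Module.End.mul_apply, pow_succ', mul_assoc]
        exact (wnorm_reduceOp_le a hK _).trans (by gcongr)
    have h1 : wnorm p K G ≤ ∑' n, wnorm p K ((T ^ n) g) := by
      unfold wnorm
      rw [ENNReal.tsum_comm]
      refine ENNReal.tsum_le_tsum fun d => ?_
      rw [ENNReal.tsum_mul_right, hG, map_sum]
      gcongr
      exact (enorm_sum_le _ _).trans (ENNReal.sum_le_tsum _)
    refine ne_top_of_le_ne_top ?_ (h1.trans (ENNReal.tsum_le_tsum hpow))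
    rw [ENNReal.tsum_mul_right, ENNReal.tsum_geometric]
    refine ENNReal.mul_ne_top ?_ hg
    rw [one_div, ENNReal.one_sub_inv_two]
    simp
  · ext d
    -- The coefficient of `T G` at `d` only depends on coefficients of `G` of smaller weight, where
    -- the partial sum is already exact.
    have h1 : coeff d (T (s (expWeight p d + 1))) = coeff d (T G) := by
      rw [← sub_eq_zero, ← map_sub, ← map_sub]
      refine coeff_reduceOp_eq_zero a hp hh fun e he => ?_
      rw [map_sub, hs e _ (by lia), sub_self]
    have h2 : s (expWeight p d + 2) = g + T (s (expWeight p d + 1)) := by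
      change ∑ m ∈ Finset.range (expWeight p d + 1 + 1), (T ^ m) g = _
      rw [Finset.sum_range_succ', map_sum, add_comm]
      simp only [pow_succ', Module.End.mul_apply, pow_zero, Module.End.one_apply]
    rw [map_add, ← h1, ← map_add, ← h2, hs d _ (by lia)]

/-- The division theorem for convergent power series: division by series `f_j` with leading
monomials `x ^ a j`, where the leading monomial is the unique one of least weight. -/
theorem ConvPS.exists_division [Finite σ] (hp : ∀ i, 2 ≤ p i) (f : J → ConvPS σ)
    (hlead : ∀ j, coeff (a j) (ConvPS.toFormal σ (f j)) = 1)
    (htail : ∀ j d, d ≠ a j → coeff d (ConvPS.toFormal σ (f j)) ≠ 0 →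
      expWeight p (a j) < expWeight p d) (g : ConvPS σ) :
    ∃ (u : J → ConvPS σ) (r : ConvPS σ), g = ∑ j, u j * f j + r ∧
      ∀ j d, a j ≤ d → coeff d (ConvPS.toFormal σ r) = 0 := by
  let h (j : J) : MvPowerSeries σ ℂ := monomial (a j) 1 - ConvPS.toFormal σ (f j)
  have hh (j : J) (d : σ →₀ ℕ) (hd : coeff d (h j) ≠ 0) : expWeight p (a j) < expWeight p d := by
    rw [map_sub, coeff_monomial] at hd
    by_cases hda : d = a j
    · rw [if_pos hda, hda, hlead, sub_self] at hd
      exact absurd rfl hd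
    · rw [if_neg hda, zero_sub, neg_ne_zero] at hd
      exact htail j d hda hd
  have hconv (j : J) : IsConvergent (h j) :=
    (convergentSubalgebra σ).sub_mem (IsConvergent.monomial (a j) 1) (f j).isConvergent
  have hsmall (j : J) : ∀ᶠ K in atTop, wnorm p K (h j) ≤ (1 / 2) * monoRadius p K (a j) := by
    obtain ⟨K₀, hK₀⟩ := (isConvergent_iff_wnorm hp _).1 (hconv j)
    exact eventually_wnorm_le hp hK₀ (hh j)
  obtain ⟨K₁, hK₁⟩ := (isConvergent_iff_wnorm hp _).1 g.isConvergent
  obtain ⟨K, hK, hKK⟩ := ((eventually_all.2 hsmall).and (eventually_ge_atTop K₁)).exists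
  obtain ⟨G, hG, hGg⟩ := exists_eq_add_reduceOp a hp hh hK (ConvPS.toFormal σ g)
    (ne_top_of_le_ne_top hK₁ (wnorm_anti hp hKK _))
  have hu (j : J) : IsConvergent (quotPart a j G) := by
    refine (isConvergent_iff_wnorm hp _).2 ⟨K, fun htop => hG ?_⟩
    rw [← top_le_iff]
    refine le_trans ?_ (sum_wnorm_quotPart_le (p := p) (K := K) a G)
    refine le_trans ?_ (Finset.single_le_sum (fun _ _ => zero_le) (Finset.mem_univ j))
    rw [htop, ENNReal.top_mul]
    exact_mod_cast (monoRadius_pos hp K (a j)).ne'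
  have hr : IsConvergent (remPart a G) := (isConvergent_iff_wnorm hp _).2
    ⟨K, ne_top_of_le_ne_top hG (wnorm_remPart_le a G)⟩
  refine ⟨fun j => ConvPS.ofFormal _ (hu j), ConvPS.ofFormal _ hr, ?_, fun j d hd => ?_⟩
  · apply ConvPS.toFormal_injective
    rw [map_add, map_sum]
    simp only [map_mul]
    change _ = ∑ j, quotPart a j G * ConvPS.toFormal σ (f j) + remPart a G
    have h1 := eq_sum_quotPart_add_remPart a G
    -- Splitting `G = ∑ Q_j x ^ a j + rem` and using `x ^ a j - h_j = f_j` turns `g = G - ∑ Q_j h_j`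
    -- into the desired division.
    have h2 : ConvPS.toFormal σ g = G - reduceOp a h G := by
      rw [eq_sub_iff_add_eq]
      exact hGg.symm
    rw [h2, reduceOp_apply]
    simp only [h, mul_sub, Finset.sum_sub_distrib]
    nth_rw 1 [h1]
    ring
  · change coeff d (remPart a G) = 0
    rw [coeff_remPart, if_neg]
    intro hnone
    exact not_le_of_selectIndex_eq_none hnone j hd

end Division

/-! ### Weights as a monomial order -/

section WeightOrder

variable {σ : Type*} {p : σ → ℕ}

lemma one_lt_expWeight (hp : ∀ i, 2 ≤ p i) {d : σ →₀ ℕ} (hd : d ≠ 0) : 1 < expWeight p d := by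
  classical
  obtain ⟨i, hi⟩ := Finsupp.ne_iff.1 hd
  have h1 : Finsupp.single i 1 ≤ d := by
    rw [Finsupp.single_le_iff]
    exact Nat.one_le_iff_ne_zero.2 hi
  rw [← add_tsub_cancel_of_le h1, expWeight_add]
  have h2 : expWeight p (Finsupp.single i 1) = p i := by simp [expWeight]
  have h3 := expWeight_pos hp (d - Finsupp.single i 1)
  rw [h2]
  have := hp i
  nlinarith

/-- With distinct primes `p_i` this is unique factorization. An injective weight singles out one
lightest monomial in every nonzero series. -/
lemma exists_expWeight_injective (σ : Type*) [Countable σ] :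
    ∃ p : σ → ℕ, (∀ i, 2 ≤ p i) ∧ Function.Injective (expWeight p) := by
  obtain ⟨e, he⟩ := exists_injective_nat σ
  let q : σ ↪ ℕ := ⟨fun i => Nat.nth Nat.Prime (e i),
    (Nat.nth_injective Nat.infinite_setOfPred_prime).comp he⟩
  have hq (i : σ) : (q i).Prime := Nat.prime_nth_prime _
  refine ⟨q, fun i => (hq i).two_le, fun d d' h => Finsupp.embDomain_injective q ?_⟩
  have key (d : σ →₀ ℕ) : (expWeight q d).factorization = Finsupp.embDomain q d := by
    have h1 : expWeight q d = (Finsupp.embDomain q d).prod (· ^ ·) := by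
      rw [Finsupp.prod_embDomain]; rfl
    rw [h1, Nat.prod_pow_factorization_eq_self]
    intro r hr
    rw [Finsupp.support_embDomain, Finset.mem_map] at hr
    obtain ⟨i, -, rfl⟩ := hr
    exact hq i
  rw [← key, ← key, h]

end WeightOrder

/-! ### Ring theory of convergent power series -/

namespace ConvPS

open MvPowerSeries (coeff)

variable {σ : Type*}

lemma ext_coeff {f g : ConvPS σ} (h : ∀ d, coeff d (toFormal σ f) = coeff d (toFormal σ g)) :
    f = g :=
  toFormal_injective (MvPowerSeries.ext h)

/-- The monomial `x ^ a` as a convergent power series. -/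
def monomial (a : σ →₀ ℕ) : ConvPS σ := ofFormal _ (IsConvergent.monomial a 1)

lemma toFormal_monomial (a : σ →₀ ℕ) :
    toFormal σ (monomial a) = MvPowerSeries.monomial a 1 := rfl

/-- The variable `x_i` as a convergent power series. -/
def X (i : σ) : ConvPS σ := monomial (Finsupp.single i 1)

lemma toFormal_X (i : σ) : toFormal σ (X i) = MvPowerSeries.X i := rfl

lemma X_ne_zero (i : σ) : X i ≠ 0 := fun h => by
  have h1 : coeff (Finsupp.single i 1) (toFormal σ (X i)) = 0 := by rw [h, map_zero, map_zero]
  rw [toFormal_X, MvPowerSeries.coeff_index_single_self_X] at h1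
  exact one_ne_zero h1

/-- The ring homomorphism `f ↦ f(0)`. -/
def constantCoeffHom (σ : Type*) : ConvPS σ →+* ℂ :=
  MvPowerSeries.constantCoeff.comp (toFormal σ).toRingHom

lemma constantCoeffHom_apply (f : ConvPS σ) : constantCoeffHom σ f = f.constantCoeff := rfl

lemma coeff_zero (f : ConvPS σ) : coeff 0 (toFormal σ f) = f.constantCoeff := rfl

instance : Nontrivial (ConvPS σ) := (constantCoeffHom σ).domain_nontrivial

instance : IsDomain (ConvPS σ) :=
  have : NoZeroDivisors (ConvPS σ) := toFormal_injective.noZeroDivisors (toFormal σ) (map_zero _)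
    (map_mul _)
  NoZeroDivisors.to_isDomain _

section Local

variable [Finite σ]

/-- Dividing `1` by `f / f(0)`, whose leading exponent is `0`, leaves no remainder, because every
exponent is `≥ 0`. -/
lemma isUnit_iff (f : ConvPS σ) : IsUnit f ↔ f.constantCoeff ≠ 0 := by
  constructor
  · intro h
    exact (h.map (constantCoeffHom σ)).ne_zero
  · intro h
    have hp : ∀ i : σ, 2 ≤ (fun _ : σ => 2) i := fun _ => le_rfl
    obtain ⟨u, r, h1, h2⟩ := exists_division (fun _ : Unit => (0 : σ →₀ ℕ)) hp
      (fun _ => f.constantCoeff⁻¹ • f) (fun _ => by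
        rw [map_smul, map_smul, coeff_zero, smul_eq_mul, inv_mul_cancel₀ h])
      (fun _ d hd _ => by
        simpa [expWeight] using one_lt_expWeight hp hd) 1
    have hr : r = 0 := ext_coeff fun d => by rw [h2 () d zero_le, map_zero, map_zero]
    rw [hr, add_zero, Fintype.sum_unique, mul_smul_comm, ← smul_mul_assoc] at h1
    exact IsUnit.of_mul_eq_one_right _ h1.symm

instance : IsLocalRing (ConvPS σ) :=
  IsLocalRing.of_isUnit_or_isUnit_one_sub_self fun f => by
    rw [isUnit_iff, isUnit_iff, ← constantCoeffHom_apply, ← constantCoeffHom_apply, map_sub,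
      map_one]
    by_cases h : constantCoeffHom σ f = 0
    · right; simp [h]
    · exact Or.inl h

lemma mem_maximalIdeal_iff (f : ConvPS σ) :
    f ∈ IsLocalRing.maximalIdeal (ConvPS σ) ↔ f.constantCoeff = 0 := by
  rw [IsLocalRing.mem_maximalIdeal, mem_nonunits_iff, isUnit_iff, not_not]

lemma X_mem_maximalIdeal (i : σ) : X i ∈ IsLocalRing.maximalIdeal (ConvPS σ) := by
  rw [mem_maximalIdeal_iff, constantCoeff, toFormal_X, MvPowerSeries.constantCoeff_X]

/-- The standard basis argument: elements of `I` with the minimal leading exponents generate `I`. -/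
instance : IsNoetherianRing (ConvPS σ) := by
  obtain ⟨p, hp, hinj⟩ := exists_expWeight_injective σ
  refine ⟨fun I => ?_⟩
  let P (a : σ →₀ ℕ) (f : ConvPS σ) : Prop := coeff a (toFormal σ f) = 1 ∧
    ∀ d, d ≠ a → coeff d (toFormal σ f) ≠ 0 → expWeight p a < expWeight p d
  let E (a : σ →₀ ℕ) : Prop := ∃ f ∈ I, P a f
  have hE (f : ConvPS σ) (hf : f ∈ I) (hf0 : f ≠ 0) : ∃ a, E a ∧ coeff a (toFormal σ f) ≠ 0 := by
    obtain ⟨d, hd⟩ : ∃ d, coeff d (toFormal σ f) ≠ 0 := by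
      by_contra! h
      exact hf0 (ext_coeff fun d => by rw [h, map_zero, map_zero])
    obtain ⟨a, ha, hmin⟩ := exists_minimalFor_of_wellFoundedLT
      (fun d => coeff d (toFormal σ f) ≠ 0) (expWeight p) ⟨d, hd⟩
    refine ⟨a, ⟨(coeff a (toFormal σ f))⁻¹ • f, ?_, ?_, fun d hda hd => ?_⟩, ha⟩
    · rw [← algebraMap_smul (ConvPS σ)]
      exact I.smul_mem _ hf
    · rw [map_smul, map_smul, smul_eq_mul, inv_mul_cancel₀ ha]
    · rw [map_smul, map_smul, smul_eq_mul] at hd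
      refine lt_of_le_of_ne ?_ fun h => hda (hinj h.symm)
      by_contra! hlt
      exact absurd (hmin (right_ne_zero_of_mul hd) hlt.le) (by simpa using hlt)
  -- Dickson's lemma.
  have hfin : {a | Minimal E a}.Finite :=
    WellQuasiOrderedLE.finite_of_isAntichain (setOfPred_minimal_antichain E)
  have := hfin.fintype
  choose g hgI hg using fun a : {a | Minimal E a} => a.2.prop
  refine Submodule.fg_def.2 ⟨Set.range g, Set.finite_range g, le_antisymm ?_ fun f hf => ?_⟩
  · rw [Submodule.span_le]
    rintro _ ⟨a, rfl⟩
    exact hgI a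
  · obtain ⟨v, r, h1, h2⟩ := exists_division (fun a : {a | Minimal E a} => a.1) hp g
      (fun a => (hg a).1) (fun a => (hg a).2) f
    have hsum : ∑ a, v a * g a ∈ Submodule.span (ConvPS σ) (Set.range g) :=
      sum_mem fun a _ => Submodule.smul_mem _ _ (Submodule.subset_span ⟨a, rfl⟩)
    have hrI : r ∈ I := by
      rw [← sub_eq_iff_eq_add'.2 h1]
      exact I.sub_mem hf (sum_mem fun a _ => I.smul_mem _ (hgI a))
    -- The remainder lies in `I`. Were it nonzero, its leading exponent would dominate some minimal
    -- one, contrary to the division theorem.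
    have hr : r = 0 := by
      by_contra hr0
      obtain ⟨d, hd, hdr⟩ := hE r hrI hr0
      obtain ⟨a, had, ha⟩ := exists_minimal_le_of_wellFoundedLT E d hd
      exact hdr (h2 ⟨a, ha⟩ d had)
    rw [h1, hr, add_zero]
    exact hsum

end Local

/-- The maximal ideal of `ℂ{t}` is generated by `t`. -/
lemma maximalIdeal_unit :
    IsLocalRing.maximalIdeal (ConvPS Unit) = Ideal.span {X ()} := by
  refine le_antisymm (fun f hf => ?_) ?_
  · have hp : ∀ i : Unit, 2 ≤ (fun _ : Unit => 2) i := fun _ => le_rfl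
    obtain ⟨u, r, h1, h2⟩ := exists_division (fun _ : Unit => Finsupp.single () 1) hp
      (fun _ => X ()) (fun _ => MvPowerSeries.coeff_index_single_self_X _)
      (fun _ d hd hd' => by
        rw [toFormal_X, MvPowerSeries.coeff_X, if_neg hd] at hd'
        exact absurd rfl hd') f
    rw [Fintype.sum_unique] at h1
    have hr : r = 0 := ext_coeff fun d => by
      rw [map_zero, map_zero]
      by_cases hd : d () = 0
      · have hd0 : d = 0 := Finsupp.ext fun _ => hd
        rw [hd0, coeff_zero]
        have h3 := congrArg (constantCoeffHom Unit) h1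
        rwa [map_add, map_mul, constantCoeffHom_apply, (mem_maximalIdeal_iff f).1 hf,
          constantCoeffHom_apply (X ()), (mem_maximalIdeal_iff _).1 (X_mem_maximalIdeal ()),
          mul_zero, zero_add, eq_comm] at h3
      · refine h2 () d ?_
        rw [Finsupp.single_le_iff]
        exact Nat.one_le_iff_ne_zero.2 hd
    rw [h1, hr, add_zero]
    exact Ideal.mul_mem_left _ _ (Ideal.mem_span_singleton_self _)
  · rw [Ideal.span_singleton_le_iff_mem]
    exact X_mem_maximalIdeal ()

instance : IsDiscreteValuationRing (ConvPS Unit) := by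
  have h : ¬ IsField (ConvPS Unit) := by
    rw [IsLocalRing.isField_iff_maximalIdeal_eq, maximalIdeal_unit, Ideal.span_singleton_eq_bot]
    exact X_ne_zero ()
  -- Entry `4` of the list says that the maximal ideal is principal.
  refine ((IsDiscreteValuationRing.TFAE (ConvPS Unit) h).out 0 4).2 ?_
  exact ⟨⟨X (), maximalIdeal_unit⟩⟩

lemma irreducible_X_unit : Irreducible (X () : ConvPS Unit) :=
  (IsDiscreteValuationRing.irreducible_iff_uniformizer _).2 maximalIdeal_unit

lemma pderiv_mul (i : σ) (f g : ConvPS σ) :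
    (f * g).pderiv i = f * g.pderiv i + g * f.pderiv i := by
  apply toFormal_injective
  rw [map_add, map_mul, map_mul]
  change MvPowerSeries.pderiv ℂ i (toFormal σ (f * g)) = _
  rw [map_mul, Derivation.leibniz]
  rfl

lemma pderiv_sum {J : Type*} (s : Finset J) (i : σ) (f : J → ConvPS σ) :
    (∑ j ∈ s, f j).pderiv i = ∑ j ∈ s, (f j).pderiv i := by
  apply toFormal_injective
  rw [map_sum]
  change MvPowerSeries.pderiv ℂ i (toFormal σ (∑ j ∈ s, f j)) = _
  rw [map_sum, map_sum]
  rfl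

lemma pderiv_zero (i : σ) : (0 : ConvPS σ).pderiv i = 0 := by
  simpa using pderiv_sum (∅ : Finset Empty) i fun _ => 0

end ConvPS

/-! ### Reduction as a tensor product, and finite global dimension -/

section TensorFibre

variable {R R' : Type*} [CommRing R] [CommRing R'] [Algebra R R'] {t : R}

/-- The map `M → R' ⊗ M`, `m ↦ 1 ⊗ m`. -/
def tensorFibreMap (R R' : Type*) [CommRing R] [CommRing R'] [Algebra R R'] (M : Type*)
    [AddCommGroup M] [Module R M] : M →ₛₗ[algebraMap R R'] R' ⊗[R] M where
  toFun m := 1 ⊗ₜ m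
  map_add' m n := TensorProduct.tmul_add _ _ _
  map_smul' r m := by
    rw [TensorProduct.tmul_smul, TensorProduct.smul_tmul', TensorProduct.smul_tmul',
      Algebra.smul_def, smul_eq_mul]

/-- This is `R/t ⊗ M ≅ M/tM`, transported along `R' ≅ R/t`. -/
lemma isModuleFibre_tensorFibreMap (h : IsRingFibre (algebraMap R R') t) (M : Type*)
    [AddCommGroup M] [Module R M] (hM : ∀ m : M, t • m = 0 → m = 0) :
    IsModuleFibre t (tensorFibreMap R R' M) where
  surjective := TensorProduct.mk_surjective R M R' h.surjective
  eq_zero_iff := fun m => by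
    have hker : RingHom.ker (algebraMap R R') = Ideal.span {t} := by
      ext r
      rw [RingHom.mem_ker, h.eq_zero_iff, Ideal.mem_span_singleton]
    let e : R' ≃ₗ[R] R ⧸ Ideal.span {t} :=
      ((Ideal.quotientEquivAlgOfEq R hker.symm).trans
        (Ideal.quotientKerAlgEquivOfSurjective (f := Algebra.ofId R R') h.surjective)).symm.toLinearEquiv
    let E := (e.rTensor M).trans (TensorProduct.quotTensorEquivQuotSMul M (Ideal.span {t}))
    have hE : E (1 ⊗ₜ m) = Submodule.Quotient.mk m := by
      simp only [E, LinearEquiv.trans_apply, LinearEquiv.rTensor_tmul]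
      have : e 1 = 1 := map_one ((Ideal.quotientEquivAlgOfEq R hker.symm).trans
        (Ideal.quotientKerAlgEquivOfSurjective (f := Algebra.ofId R R') h.surjective)).symm
      rw [this, TensorProduct.quotTensorEquivQuotSMul_mk_one_tmul]
    change (1 : R') ⊗ₜ[R] m = 0 ↔ _
    rw [← E.map_eq_zero_iff, hE, Submodule.Quotient.mk_eq_zero, Submodule.ideal_span_singleton_smul,
      Submodule.mem_smul_pointwise_iff_exists]
    simp [eq_comm]
  regular := hM

/-- Finiteness of the global dimension passes from `R / tR` to `R`. -/
theorem exists_hasProjectiveDimensionLT_of_fibre {R R' : Type u} [CommRing R] [CommRing R']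
    [IsLocalRing R] [IsNoetherianRing R] [IsLocalRing R'] {φ : R →+* R'} {t : R}
    (hφ : IsRingFibre φ t) (ht : t ∈ IsLocalRing.maximalIdeal R)
    (h : ∃ d : ℕ, ∀ (M : Type u) [AddCommGroup M] [Module R' M] [Module.Finite R' M],
      HasProjectiveDimensionLT (ModuleCat.of R' M) (d + 1)) :
    ∃ d : ℕ, ∀ (M : Type u) [AddCommGroup M] [Module R M] [Module.Finite R M],
      HasProjectiveDimensionLT (ModuleCat.of R M) (d + 1) := by
  obtain ⟨d, h⟩ := h
  algebraize [φ]
  -- The module `M` may have `t`-torsion, but its first syzygy lies in some `Rⁿ` and has none;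
  -- passing to it costs one dimension.
  refine ⟨d + 1, fun M _ _ _ => ?_⟩
  obtain ⟨n, z, hz⟩ := exists_linearCombination_surjective R M
  rw [hasProjectiveDimensionLT_ker_iff _ hz]
  have hq := isModuleFibre_tensorFibreMap hφ (LinearMap.ker (Fintype.linearCombination R z))
    (fun m hm => Subtype.ext (funext fun i => hφ.regular _
      (congrFun (congrArg Subtype.val hm) i)))
  exact hq.hasProjectiveDimensionLT hφ ht d (h _)

end TensorFibre

namespace ConvPS

open MvPowerSeries (coeff)

/-- Killing the single variable `x_b` identifies `ℂ{x_j : j ≠ b}` with `ℂ{x} / (x_b)`. -/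
theorem isRingFibre_killCompl {σ τ : Type*} [Finite τ] (e : σ ↪ τ) {b : τ}
    (hb : b ∉ Set.range e) (hcover : ∀ x, x ≠ b → x ∈ Set.range e) :
    IsRingFibre (restrictHom (MvPowerSeries.killCompl e)
      fun _ h => h.killCompl e : ConvPS τ →ₐ[ℂ] ConvPS σ).toRingHom (X b) where
  surjective f := ⟨ofFormal _ (f.isConvergent.rename e),
    toFormal_injective (MvPowerSeries.killCompl_rename_app (e := e) (toFormal σ f))⟩
  eq_zero_iff f := by
    set φ := (restrictHom (MvPowerSeries.killCompl e)
      fun _ h => h.killCompl e : ConvPS τ →ₐ[ℂ] ConvPS σ).toRingHom with hφ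
    have hform (g : ConvPS τ) : toFormal σ (φ g) = MvPowerSeries.killCompl e (toFormal τ g) := rfl
    have hX : φ (X b) = 0 := toFormal_injective (by
      rw [hform, toFormal_X, MvPowerSeries.killCompl_X_eq_zero hb, map_zero])
    constructor
    · intro hf
      have hp : ∀ i : τ, 2 ≤ (fun _ : τ => 2) i := fun _ => le_rfl
      obtain ⟨u, r, h1, h2⟩ := exists_division (fun _ : Unit => Finsupp.single b 1) hp
        (fun _ => X b) (fun _ => MvPowerSeries.coeff_index_single_self_X _)
        (fun _ d hd hd' => by
          classical
          rw [toFormal_X, MvPowerSeries.coeff_X, if_neg hd] at hd'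
          exact absurd rfl hd') f
      rw [Fintype.sum_unique] at h1
      have hr' : φ r = 0 := by
        have h3 := congrArg φ h1
        rwa [map_add, map_mul, hX, mul_zero, zero_add, hf, eq_comm] at h3
      -- The remainder on division by `x_b` does not involve `x_b`, so it is determined by its
      -- image, which is zero.
      have hr : r = 0 := ext_coeff fun d => by
        rw [map_zero, map_zero]
        by_cases hd : d b = 0
        · obtain ⟨d', rfl⟩ : d ∈ Set.range (Finsupp.embDomain e) := by
            rw [Finsupp.mem_range_embDomain_iff]
            intro x hx
            refine hcover x fun hxb => ?_
            subst hxb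
            exact Finsupp.mem_support_iff.1 hx hd
          have h4 := congrArg (fun g => coeff d' (toFormal σ g)) hr'
          simpa [hform, MvPowerSeries.coeff_killCompl] using h4
        · refine h2 () d ?_
          rw [Finsupp.single_le_iff]
          exact Nat.one_le_iff_ne_zero.2 hd
      rw [h1, hr, add_zero]
      exact Dvd.intro_left _ rfl
    · rintro ⟨g, rfl⟩
      rw [map_mul, hX, zero_mul]
  regular f hf := (mul_eq_zero.1 hf).resolve_left (X_ne_zero b)

lemma isField_of_isEmpty (σ : Type*) [IsEmpty σ] : IsField (ConvPS σ) := by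
  rw [IsLocalRing.isField_iff_maximalIdeal_eq, eq_bot_iff]
  intro f hf
  refine ext_coeff fun d => ?_
  rw [Subsingleton.elim d 0, coeff_zero, (mem_maximalIdeal_iff f).1 hf, map_zero, map_zero]

/-- The global dimension of `ℂ{x_1, …, x_n}` is finite. -/
theorem exists_hasProjectiveDimensionLT (n : ℕ) :
    ∃ d : ℕ, ∀ (M : Type) [AddCommGroup M] [Module (ConvPS (Fin n)) M]
      [Module.Finite (ConvPS (Fin n)) M],
      HasProjectiveDimensionLT (ModuleCat.of (ConvPS (Fin n)) M) (d + 1) := by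
  induction n with
  | zero =>
    refine ⟨0, fun M _ _ _ => ?_⟩
    rw [zero_add, hasProjectiveDimensionLT_one_iff]
    let := (isField_of_isEmpty (Fin 0)).toField
    exact Module.Projective.of_free
  | succ n ih =>
    refine exists_hasProjectiveDimensionLT_of_fibre (isRingFibre_killCompl (Fin.succEmb n) (b := 0)
      ?_ ?_) (X_mem_maximalIdeal _) ih
    · simp
    · intro x hx
      obtain ⟨y, rfl⟩ := Fin.exists_succ_eq.2 hx
      exact ⟨y, rfl⟩

/-- The substitution `t = 0` identifies `ℂ{x}` with `ℂ{x, t} / (t)`. -/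
theorem isRingFibre_atZero (ι : Type*) [Finite ι] :
    IsRingFibre (atZero ι).toRingHom (X (Sum.inr ())) :=
  isRingFibre_killCompl _ (by simp) fun x hx => by
    rcases x with i | j
    · exact ⟨i, rfl⟩
    · exact absurd rfl hx

theorem exists_hasProjectiveDimensionLT_sum (n : ℕ) :
    ∃ d : ℕ, ∀ (M : Type) [AddCommGroup M] [Module (ConvPS (Fin n ⊕ Unit)) M]
      [Module.Finite (ConvPS (Fin n ⊕ Unit)) M],
      HasProjectiveDimensionLT (ModuleCat.of (ConvPS (Fin n ⊕ Unit)) M) (d + 1) :=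
  exists_hasProjectiveDimensionLT_of_fibre (isRingFibre_atZero (Fin n)) (X_mem_maximalIdeal _)
    (exists_hasProjectiveDimensionLT n)

end ConvPS

/-! ### Weierstrass finiteness -/

/-- If `T / tT` has finite length, then every element of the maximal ideal has a power that acts on
`T` as a multiple of `t`. -/
lemma exists_pow_add_mul_smul_eq_zero {S T : Type*} [CommRing S] [IsLocalRing S] [AddCommGroup T]
    [Module S T] [Module.Finite S T] {t : S} (hfin : Module.length S (SMulCoker t T) ≠ ⊤) {x : S}
    (hx : x ∈ IsLocalRing.maximalIdeal S) :
    ∃ (M : ℕ) (h : S), ∀ m : T, (x ^ M + t * h) • m = 0 := by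
  rw [Module.length_ne_top_iff, isFiniteLength_iff_isNoetherian_isArtinian] at hfin
  obtain ⟨_, _⟩ := hfin
  let f : Module.End S (SMulCoker t T) := Algebra.lsmul S S _ x
  have hf (n : ℕ) (q : SMulCoker t T) : (f ^ n) q = x ^ n • q := by
    rw [← map_pow]; rfl
  obtain ⟨n, hn⟩ := IsArtinian.monotone_stabilizes f.iterateRange
  -- The stable image satisfies `x · im = im`, so it vanishes by Nakayama's lemma; that is, `xⁿ T ⊆
  -- tT`.
  have hbot : LinearMap.range (f ^ n) = ⊥ := by
    refine Submodule.eq_bot_of_le_smul_of_le_jacobson_bot (Ideal.span {x}) _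
      (IsNoetherian.noetherian _) ?_ ?_
    · have h1 : LinearMap.range (f ^ n) = LinearMap.range (f ^ (n + 1)) := hn (n + 1) n.le_succ
      intro q hq
      rw [h1] at hq
      obtain ⟨q', rfl⟩ := hq
      rw [hf, pow_succ', mul_smul]
      exact Submodule.smul_mem_smul (Ideal.mem_span_singleton_self x) ⟨q', hf n q'⟩
    · rw [Ideal.span_singleton_le_iff_mem]
      exact IsLocalRing.maximalIdeal_le_jacobson _ hx
  -- Cayley–Hamilton: `xⁿ` satisfies on `T` a monic polynomial whose lower coefficients are
  -- divisible by `t`.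
  obtain ⟨p, hp, -, hcoeff, hp0⟩ :=
    LinearMap.exists_monic_and_natDegree_eq_and_coeff_mem_pow_and_aeval_eq_zero
      (R := S) (M := T) (Algebra.lsmul S S T (x ^ n)) (Ideal.span {t}) (by
        rintro _ ⟨m, rfl⟩
        have h1 : Submodule.Quotient.mk (p := LinearMap.range (LinearMap.lsmul S T t))
            (x ^ n • m) = 0 := by
          rw [Submodule.Quotient.mk_smul, ← hf, ← Submodule.mem_bot S, ← hbot]
          exact ⟨_, rfl⟩
        obtain ⟨m', hm'⟩ := (Submodule.Quotient.mk_eq_zero _).1 h1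
        change x ^ n • m ∈ _
        rw [← hm']
        exact Submodule.smul_mem_smul (Ideal.mem_span_singleton_self t) trivial)
  rw [Polynomial.aeval_algHom_apply] at hp0
  have hdvd : t ∣ ∑ k ∈ Finset.range p.natDegree, p.coeff k * (x ^ n) ^ k := by
    refine Finset.dvd_sum fun k hk => Dvd.dvd.mul_right ?_ _
    rw [← Ideal.mem_span_singleton]
    exact Ideal.pow_le_self (by have := Finset.mem_range.1 hk; lia) (hcoeff k)
  obtain ⟨h, hh⟩ := hdvd
  refine ⟨n * p.natDegree, h, fun m => ?_⟩
  have h1 := LinearMap.congr_fun hp0 m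
  rw [Polynomial.coe_aeval_eq_eval, Polynomial.eval_eq_sum_range, Finset.sum_range_succ, hh,
    Polynomial.Monic.coeff_natDegree hp, one_mul, ← pow_mul, add_comm] at h1
  exact h1

namespace ConvPS

open MvPowerSeries (coeff)

variable {ι : Type*}

/-- The coefficient of `x ^ κ` in a series in `x` and `t`, as a series in `t`. -/
def coeffX (κ : ι →₀ ℕ) (f : ConvPS (ι ⊕ Unit)) : ConvPS Unit :=
  ofFormal (fun k => coeff (κ.sumElim k) (toFormal _ f)) (by
    obtain ⟨r, hr, h⟩ := f.isConvergent
    have hinj : Function.Injective fun k : Unit →₀ ℕ => κ.sumElim k := fun k k' hk => by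
      ext
      exact DFunLike.congr_fun hk (Sum.inr ())
    refine ⟨r, hr, ((h.comp_injective hinj).mul_left (r ^ κ.degree)⁻¹).congr fun k => ?_⟩
    have hdeg : (κ.sumElim k).degree = κ.degree + k.degree := by
      rw [Finsupp.sumElim_eq_add, map_add]
      have h1 := IsConvergent.degree_embDomain (Function.Embedding.inl : ι ↪ ι ⊕ Unit) κ
      have h2 := IsConvergent.degree_embDomain (Function.Embedding.inr : Unit ↪ ι ⊕ Unit) k
      rw [Finsupp.embDomain_eq_mapDomain] at h1 h2
      exact congrArg₂ _ h1 h2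
    simp only [Function.comp, hdeg, pow_add]
    change _ = ‖coeff (κ.sumElim k) (toFormal _ f)‖ * _
    field_simp)

lemma toFormal_parameterInclusion (c : ConvPS Unit) :
    toFormal _ (parameterInclusion ι c) =
      MvPowerSeries.rename (Function.Embedding.inr : Unit ↪ ι ⊕ Unit) (toFormal _ c) := rfl

lemma coeff_parameterInclusion_mul_monomial [DecidableEq ι] (c : ConvPS Unit) (κ κ' : ι →₀ ℕ)
    (k : Unit →₀ ℕ) :
    coeff (κ'.sumElim k) (toFormal _ (parameterInclusion ι c * monomial (κ.sumElim 0))) =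
      if κ' = κ then coeff k (toFormal _ c) else 0 := by
  rw [map_mul, toFormal_monomial, MvPowerSeries.coeff_mul_monomial, mul_one,
    toFormal_parameterInclusion]
  have hsub : κ'.sumElim k - κ.sumElim 0 = (κ' - κ).sumElim k := by
    ext (i | i) <;> simp
  have hle : κ.sumElim (0 : Unit →₀ ℕ) ≤ κ'.sumElim k ↔ κ ≤ κ' := by
    constructor
    · exact fun h i => by simpa using h (Sum.inl i)
    · rintro h (i | i)
      · simpa using h i
      · simp
  rw [hsub]
  simp only [hle]
  by_cases h : κ' = κ
  · subst h
    rw [if_pos le_rfl, if_pos rfl, tsub_self, ← Finsupp.embDomain_inr,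
      MvPowerSeries.coeff_embDomain_rename]
  · rw [if_neg h]
    split_ifs with h'
    · apply MvPowerSeries.coeff_rename_eq_zero
      rintro ⟨y, hy⟩
      refine h (le_antisymm ?_ h')
      rw [← tsub_eq_zero_iff_le]
      ext i
      have h2 := DFunLike.congr_fun hy (Sum.inl i)
      rw [Finsupp.mapDomain_of_notMem_range _ _ (by simp)] at h2
      simpa using h2.symm
    · rfl

/-- A series that is polynomial in `x` with exponents at most `m` as a polynomial in `x`. -/
lemma eq_sum_coeffX_mul_monomial [DecidableEq ι] (m : ι →₀ ℕ) (r : ConvPS (ι ⊕ Unit))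
    (hr : ∀ (κ : ι →₀ ℕ) (k : Unit →₀ ℕ), ¬ κ ≤ m → coeff (κ.sumElim k) (toFormal _ r) = 0) :
    r = ∑ κ ∈ Finset.Icc 0 m, parameterInclusion ι (coeffX κ r) * monomial (κ.sumElim 0) := by
  classical
  refine ext_coeff fun d => ?_
  rw [← Finsupp.comapDomain_sumElim_comapDomain d]
  generalize Finsupp.comapDomain Sum.inl d _ = κ'
  generalize Finsupp.comapDomain Sum.inr d _ = k
  rw [map_sum, map_sum]
  simp only [coeff_parameterInclusion_mul_monomial, Finset.sum_ite_eq, Finset.mem_Icc, zero_le,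
    true_and]
  split_ifs with h
  · rfl
  · exact hr κ' k h

/-- Weierstrass finiteness: a finitely generated `ℂ{x, t}`-module `T` such that `T / tT` has finite
length is finitely generated over `ℂ{t}`. -/
theorem finite_of_length_smulCoker_ne_top [Finite ι] {T : Type*} [AddCommGroup T]
    [Module (ConvPS (ι ⊕ Unit)) T] [Module.Finite (ConvPS (ι ⊕ Unit)) T] [Module (ConvPS Unit) T]
    (hsmul : ∀ (c : ConvPS Unit) (m : T), c • m = parameterInclusion ι c • m)
    (hfin : Module.length (ConvPS (ι ⊕ Unit))
      (SMulCoker (X (Sum.inr ()) : ConvPS (ι ⊕ Unit)) T) ≠ ⊤) :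
    Module.Finite (ConvPS Unit) T := by
  classical
  have := Fintype.ofFinite ι
  choose m h hm using fun i : ι =>
    exists_pow_add_mul_smul_eq_zero hfin (X_mem_maximalIdeal (Sum.inl i))
  let m' : ι →₀ ℕ := Finsupp.equivFunOnFinite.symm m
  let a (i : ι) : ι ⊕ Unit →₀ ℕ := Finsupp.single (Sum.inl i) (m i)
  -- The variable `t` is given a weight exceeding all `2 ^ m i`, so that `x_i ^ m i` becomes the
  -- leading monomial of `x_i ^ m i + t h_i`.
  let p : ι ⊕ Unit → ℕ := Sum.elim (fun _ => 2) fun _ => 2 ^ (m'.degree + 1)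
  have hp : ∀ i, 2 ≤ p i := by
    rintro (i | i)
    · exact le_rfl
    · exact le_self_pow₀ (by norm_num : 1 ≤ 2) (by lia)
  let f (i : ι) : ConvPS (ι ⊕ Unit) := X (Sum.inl i) ^ m i + X (Sum.inr ()) * h i
  have hXh (i : ι) (d : ι ⊕ Unit →₀ ℕ) : coeff d (toFormal _ (X (Sum.inr ()) * h i)) =
      if Finsupp.single (Sum.inr ()) 1 ≤ d then
        coeff (d - Finsupp.single (Sum.inr ()) 1) (toFormal _ (h i)) else 0 := by
    rw [map_mul, toFormal_X, MvPowerSeries.X_def, MvPowerSeries.coeff_monomial_mul, one_mul]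
  have hcoeff (i : ι) (d : ι ⊕ Unit →₀ ℕ) : coeff d (toFormal _ (f i)) =
      (if d = a i then 1 else 0) + if Finsupp.single (Sum.inr ()) 1 ≤ d then
        coeff (d - Finsupp.single (Sum.inr ()) 1) (toFormal _ (h i)) else 0 := by
    rw [map_add, map_add, hXh, map_pow, toFormal_X, MvPowerSeries.coeff_X_pow]
  have hdiv := exists_division a hp f
    (fun i => by
      rw [hcoeff, if_pos rfl, if_neg, add_zero]
      simp [a])
    (fun i d hd hd' => by
      rw [hcoeff, if_neg hd, zero_add] at hd'
      have hle : Finsupp.single (Sum.inr ()) 1 ≤ d := by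
        by_contra hle
        rw [if_neg hle] at hd'
        exact hd' rfl
      have h1 : expWeight p (a i) = 2 ^ m i := by simp [a, expWeight, p]
      have h2 : expWeight p (Finsupp.single (Sum.inr ()) 1) = 2 ^ (m'.degree + 1) := by
        simp [expWeight, p]
      rw [h1, ← add_tsub_cancel_of_le hle, expWeight_add, h2]
      refine lt_of_lt_of_le ?_ (Nat.le_mul_of_pos_right _ (expWeight_pos hp _))
      have h3 : m i ≤ m'.degree := Finsupp.le_degree i m'
      exact Nat.pow_lt_pow_right (by norm_num) (by lia))
  obtain ⟨s, hs⟩ := (Module.Finite.fg_top : (⊤ : Submodule (ConvPS (ι ⊕ Unit)) T).FG)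
  -- Modulo the series `f i`, which kill `T`, every series is a polynomial in `x` over `ℂ{t}` with
  -- exponents in a finite box. The products of those monomials with the generators `s` hence
  -- suffice.
  let G : Finset T := Finset.image₂ (fun κ z => (monomial (κ.sumElim 0) : ConvPS (ι ⊕ Unit)) • z)
    (Finset.Icc 0 m') s
  refine ⟨⟨G, eq_top_iff.2 fun x _ => ?_⟩⟩
  have hx : x ∈ Submodule.span (ConvPS (ι ⊕ Unit)) (s : Set T) := hs ▸ trivial
  have key (g : ConvPS (ι ⊕ Unit)) (z : T) (hz : z ∈ s) :
      g • z ∈ Submodule.span (ConvPS Unit) (G : Set T) := by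
    obtain ⟨u, r, hg, hr⟩ := hdiv g
    have h1 : g • z = r • z := by
      rw [hg, add_smul, Finset.sum_smul, Finset.sum_eq_zero, zero_add]
      intro i _
      rw [mul_smul, hm, smul_zero]
    rw [h1, eq_sum_coeffX_mul_monomial m' r, Finset.sum_smul]
    · refine sum_mem fun κ hκ => ?_
      rw [mul_smul, ← hsmul]
      exact Submodule.smul_mem _ _ (Submodule.subset_span
        (Finset.mem_coe.2 (Finset.mem_image₂_of_mem hκ hz)))
    · intro κ k hκ
      obtain ⟨i, hi⟩ : ∃ i, ¬ κ i ≤ m' i := by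
        by_contra! hall
        exact hκ hall
      refine hr i _ ?_
      rw [Finsupp.single_le_iff]
      exact (not_le.1 hi).le
  obtain ⟨c, -, rfl⟩ := Submodule.mem_span_finset.1 hx
  exact sum_mem fun z hz => key _ _ hz

end ConvPS

/-! ### Lengths under restriction of scalars -/

section RestrictScalars

variable {A R : Type*} [CommRing A] [CommRing R] [Algebra A R] (T : Type*) [AddCommGroup T]
  [Module A T] [Module R T] [IsScalarTower A R T]

lemma length_smulCoker_algebraMap (a : A) :
    Module.length A (SMulCoker a T) = Module.length A (SMulCoker (algebraMap A R a) T) := by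
  have h : LinearMap.range (LinearMap.lsmul A T a) =
      (LinearMap.range (LinearMap.lsmul R T (algebraMap A R a))).restrictScalars A := by
    ext x
    simp
  exact ((Submodule.quotEquivOfEq _ _ h).trans
    (Submodule.Quotient.restrictScalarsEquiv A _)).length_eq

lemma length_smulKer_algebraMap (a : A) :
    Module.length A (SMulKer a T) = Module.length A (SMulKer (algebraMap A R a) T) := by
  have h : LinearMap.ker (LinearMap.lsmul A T a) =
      (LinearMap.ker (LinearMap.lsmul R T (algebraMap A R a))).restrictScalars A := by
    ext x
    simp
  exact (LinearEquiv.ofEq _ _ h).length_eq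

lemma length_eq_of_surjective_algebraMap (h : Function.Surjective (algebraMap A R)) :
    Module.length A T = Module.length R T :=
  have : RingHomSurjective (algebraMap A R) := ⟨h⟩
  length_eq_of_bijective (φ := algebraMap A R)
    { toFun := id, map_add' := fun _ _ => rfl, map_smul' := fun a x => (algebraMap_smul R a x).symm }
    Function.bijective_id

/-- If the residue field extension of a local homomorphism is trivial, then lengths do not change
under restriction of scalars. -/
lemma length_restrictScalars_eq [IsLocalRing A] [IsLocalRing R] [IsLocalHom (algebraMap A R)]
    (h : ∀ r : R, ∃ a : A, r - algebraMap A R a ∈ IsLocalRing.maximalIdeal R) :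
    Module.length A T = Module.length R T := by
  have hbij : Function.Bijective (Algebra.linearMap (IsLocalRing.ResidueField A)
      (IsLocalRing.ResidueField R)) := by
    refine ⟨(algebraMap (IsLocalRing.ResidueField A) (IsLocalRing.ResidueField R)).injective, ?_⟩
    intro y
    obtain ⟨r, rfl⟩ := IsLocalRing.residue_surjective y
    obtain ⟨a, ha⟩ := h r
    refine ⟨IsLocalRing.residue A a, ?_⟩
    rw [← sub_eq_zero, ← neg_eq_zero, neg_sub]
    exact (IsLocalRing.residue_eq_zero_iff _).2 ha
  rw [IsLocalRing.length_restrictScalars (A := A) (B := R) (M := T),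
    ← (LinearEquiv.ofBijective _ hbij).length_eq,
    Module.length_eq_one (IsLocalRing.ResidueField A) (IsLocalRing.ResidueField A), mul_one]

end RestrictScalars

/-! ### Comparing ranks with lengths -/

section Count

variable {A R R' : Type u} [CommRing A] [CommRing R] [CommRing R'] [Algebra A R] [IsDomain A]
  [IsDiscreteValuationRing A] [IsNoetherianRing R] {φ : R →+* R'} {a : A}
  {M M' : Type u} [AddCommGroup M] [Module R M] [Module A M] [IsScalarTower A R M]
  [Module.Finite R M] [AddCommGroup M'] [Module R' M'] {q : M →ₛₗ[φ] M'}

/-- The difference of the ranks over a discrete valuation ring of the two homology modules of a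
two-periodic complex is the difference of the lengths of the homology of its special fibre. -/
theorem length_add_finrank_matHomology (ha : Irreducible a)
    (hφ : IsRingFibre φ (algebraMap A R a)) (hq : IsModuleFibre (algebraMap A R a) q)
    (hlen : ∀ (T : Type u) [AddCommGroup T] [Module A T] [Module R T] [IsScalarTower A R T],
      Module.length A T = Module.length R T)
    (hfinite : ∀ (T : Type u) [AddCommGroup T] [Module A T] [Module R T] [IsScalarTower A R T]
      [Module.Finite R T], Module.length R (SMulCoker (algebraMap A R a) T) ≠ ⊤ →
        Module.Finite A T)
    {m : ℕ} {B C : Matrix (Fin m) (Fin m) R} (hBC : B * C = 0) (hCB : C * B = 0)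
    (hB : Module.length R' (MatHomology M' (B.map φ) (C.map φ)) ≠ ⊤)
    (hC : Module.length R' (MatHomology M' (C.map φ) (B.map φ)) ≠ ⊤) :
    Module.Finite A (MatHomology M B C) ∧ Module.Finite A (MatHomology M C B) ∧
      Module.length R' (MatHomology M' (B.map φ) (C.map φ)) +
          Module.finrank A (MatHomology M C B) =
        Module.length R' (MatHomology M' (C.map φ) (B.map φ)) +
          Module.finrank A (MatHomology M B C) := by
  rw [length_matHomology_fibre hφ hq hBC hCB] at hB ⊢
  rw [length_matHomology_fibre hφ hq hCB hBC] at hC ⊢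
  -- The length of `H/tH` is a summand of that of the fibre homology, hence finite.
  have h1 : Module.Finite A (MatHomology M B C) := hfinite _ fun h => hB (by rw [h, top_add])
  have h2 : Module.Finite A (MatHomology M C B) := hfinite _ fun h => hC (by rw [h, top_add])
  refine ⟨h1, h2, ?_⟩
  have key (T : Type u) [AddCommGroup T] [Module A T] [Module R T] [IsScalarTower A R T]
      [Module.Finite A T] : Module.length R (SMulCoker (algebraMap A R a) T) =
        Module.finrank A T + Module.length R (SMulKer (algebraMap A R a) T) := by
    rw [← hlen, ← hlen, ← length_smulCoker_algebraMap, ← length_smulKer_algebraMap]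
    exact length_smulCoker_eq ha T
  -- Both sides become the sum of the two ranks and of the lengths of the two `t`-torsion
  -- submodules.
  rw [key, key]
  ring

end Count

/-! ### Hypersurface rings and isolated singularities -/

namespace HypersurfaceRing

variable {σ : Type*} (g : ConvPS σ)

instance algebraConvPS : Algebra (ConvPS σ) (HypersurfaceRing g) :=
  inferInstanceAs (Algebra (ConvPS σ) (ConvPS σ ⧸ Ideal.span {g}))

lemma algebraMap_surjective : Function.Surjective (algebraMap (ConvPS σ) (HypersurfaceRing g)) :=
  Ideal.Quotient.mk_surjective

lemma algebraMap_eq_zero_iff (s : ConvPS σ) :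
    algebraMap (ConvPS σ) (HypersurfaceRing g) s = 0 ↔ g ∣ s :=
  Ideal.Quotient.eq_zero_iff_mem.trans Ideal.mem_span_singleton

instance [Finite σ] : IsNoetherianRing (HypersurfaceRing g) :=
  isNoetherianRing_of_surjective _ _ _ (algebraMap_surjective g)

variable {g}

lemma nontrivial [Finite σ] (hg : g.constantCoeff = 0) : Nontrivial (HypersurfaceRing g) := by
  refine Ideal.Quotient.nontrivial_iff.2 fun h => ?_
  rw [Ideal.span_singleton_eq_top, ConvPS.isUnit_iff] at h
  exact h hg

lemma isLocalRing [Finite σ] (hg : g.constantCoeff = 0) : IsLocalRing (HypersurfaceRing g) :=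
  have := nontrivial hg
  IsLocalRing.of_surjective' _ (algebraMap_surjective g)

/-- The homology of a matrix factorization of an isolated singularity has finite length. -/
theorem length_matHomology_ne_top [Finite σ] (hg : IsIsolatedSingularity g) {m : ℕ}
    {A B : Matrix (Fin m) (Fin m) (ConvPS σ)} (hBA : B * A = Matrix.scalar (Fin m) g)
    (M : Type*) [AddCommGroup M] [Module (HypersurfaceRing g) M]
    [Module.Finite (HypersurfaceRing g) M] :
    Module.length (HypersurfaceRing g)
      (MatHomology M (A.map (algebraMap (ConvPS σ) (HypersurfaceRing g)))
        (B.map (algebraMap (ConvPS σ) (HypersurfaceRing g)))) ≠ ⊤ := by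
  set α := algebraMap (ConvPS σ) (HypersurfaceRing g)
  set H := MatHomology M (A.map α) (B.map α)
  let : Module (ConvPS σ) H := Module.compHom H α
  have : IsScalarTower (ConvPS σ) (HypersurfaceRing g) H := IsScalarTower.of_compHom _ _ _
  -- The Leibniz rule applied to `B A = g`.
  have hder (i : σ) : Matrix.scalar (Fin m) (g.pderiv i) =
      B * A.map (ConvPS.pderiv i) + B.map (ConvPS.pderiv i) * A := by
    ext j k
    have h1 := congrArg (ConvPS.pderiv i) (congrFun (congrFun hBA j) k)
    have h2 : (Matrix.scalar (Fin m) g j k).pderiv i =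
        Matrix.scalar (Fin m) (g.pderiv i) j k := by
      by_cases hjk : j = k
      · subst hjk; simp
      · simp [Matrix.diagonal_apply_ne _ hjk, ConvPS.pderiv_zero]
    rw [← h2, ← h1, Matrix.mul_apply, ConvPS.pderiv_sum, Matrix.add_apply, Matrix.mul_apply,
      Matrix.mul_apply, ← Finset.sum_add_distrib]
    refine Finset.sum_congr rfl fun l _ => ?_
    rw [ConvPS.pderiv_mul, Matrix.map_apply, Matrix.map_apply, mul_comm (A l k)]
  -- On `ker A` the term `(∂B) A` vanishes, so `∂g` acts as `B (∂A)` and lands in `im B`. The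
  -- homology is then finite over the Artinian ring `ℂ{x}/(∂g/∂x_i)`.
  have hkill : Module.IsTorsionBySet (ConvPS σ) H (jacobianIdeal g) := by
    rw [jacobianIdeal, ← Module.isTorsionBySet_iff_is_torsion_by_span]
    rintro x ⟨_, i, rfl⟩
    obtain ⟨⟨v, hv⟩, rfl⟩ := Submodule.Quotient.mk_surjective _ x
    refine (Submodule.Quotient.mk_eq_zero _
      (x := α (g.pderiv i) • (⟨v, hv⟩ : LinearMap.ker (matAct M (A.map α))))).2 ?_
    refine ⟨matAct M ((A.map (ConvPS.pderiv i)).map α) v, ?_⟩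
    have h1 := congrArg (fun C => C.map α) (hder i)
    rw [Matrix.map_add _ (map_add α), Matrix.map_mul, Matrix.map_mul] at h1
    have h2 : (Matrix.scalar (Fin m) (g.pderiv i)).map α =
        Matrix.scalar (Fin m) (α (g.pderiv i)) := by
      ext j k
      by_cases hjk : j = k
      · subst hjk; simp
      · simp [Matrix.diagonal_apply_ne _ hjk]
    have h3 := congrArg (fun C => matAct M C v) h1
    simp only [h2, matAct_scalar_apply, matAct_add_apply, matAct_mul_apply] at h3
    rw [LinearMap.mem_ker] at hv
    rw [hv, map_zero, add_zero] at h3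
    exact h3.symm
  let := hkill.module
  have : IsScalarTower (ConvPS σ) (ConvPS σ ⧸ jacobianIdeal g) H := hkill.isScalarTower
  have := hg.2
  have : IsArtinianRing (ConvPS σ ⧸ jacobianIdeal g) := IsArtinianRing.of_finite ℂ _
  have : Module.Finite (ConvPS σ) (HypersurfaceRing g) :=
    Module.Finite.of_surjective (Algebra.linearMap _ _) (algebraMap_surjective g)
  have : Module.Finite (ConvPS σ) H := Module.Finite.trans (HypersurfaceRing g) H
  have : Module.Finite (ConvPS σ ⧸ jacobianIdeal g) H := Module.Finite.of_restrictScalars_finite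
    (ConvPS σ) _ _
  rw [← length_eq_of_surjective_algebraMap H (algebraMap_surjective g),
    length_eq_of_surjective_algebraMap H (R := ConvPS σ ⧸ jacobianIdeal g)
      Ideal.Quotient.mk_surjective]
  exact Module.length_ne_top

end HypersurfaceRing

/-- Regularity of `t` on `ℂ{x, t}/(F)`: if `t s = F u`, then setting `t = 0` gives `f · u(x, 0) =
0`. As `f ≠ 0`, `t` divides `u`, and cancelling it shows `F ∣ s`. -/
lemma isRingFibre_toSpecialFibre {ι : Type*} [Finite ι] {F : ConvPS (ι ⊕ Unit)}
    (hf : atZero ι F ≠ 0) :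
    IsRingFibre (toSpecialFibre F)
      (algebraMap (ConvPS (ι ⊕ Unit)) (HypersurfaceRing F) (ConvPS.X (Sum.inr ()))) := by
  have h0 := ConvPS.isRingFibre_atZero ι
  have hcomm (s : ConvPS (ι ⊕ Unit)) : toSpecialFibre F (algebraMap _ _ s) =
      algebraMap (ConvPS ι) (HypersurfaceRing (atZero ι F)) (atZero ι s) := rfl
  have hX : atZero ι (ConvPS.X (Sum.inr ())) = 0 := (h0.eq_zero_iff _).2 dvd_rfl
  refine ⟨fun r => ?_, fun r => ?_, fun r hr => ?_⟩
  · obtain ⟨s, rfl⟩ := HypersurfaceRing.algebraMap_surjective _ r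
    obtain ⟨s', rfl⟩ := h0.surjective s
    exact ⟨algebraMap _ _ s', hcomm s'⟩
  · obtain ⟨s, rfl⟩ := HypersurfaceRing.algebraMap_surjective _ r
    rw [hcomm, HypersurfaceRing.algebraMap_eq_zero_iff]
    constructor
    · rintro ⟨c, hc⟩
      obtain ⟨c', rfl⟩ := h0.surjective c
      obtain ⟨w, hw⟩ := (h0.eq_zero_iff (s - F * c')).1 (by
        rw [map_sub, map_mul, sub_eq_zero]
        exact hc)
      rw [sub_eq_iff_eq_add] at hw
      rw [hw, map_add, map_mul, map_mul, (HypersurfaceRing.algebraMap_eq_zero_iff F F).2 dvd_rfl,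
        zero_mul, add_zero]
      exact dvd_mul_right _ _
    · rintro ⟨c, hc⟩
      obtain ⟨w, rfl⟩ := HypersurfaceRing.algebraMap_surjective _ c
      rw [← map_mul, ← sub_eq_zero, ← map_sub, HypersurfaceRing.algebraMap_eq_zero_iff] at hc
      have h1 := map_dvd (atZero ι) hc
      rwa [map_sub, map_mul, hX, zero_mul, sub_zero] at h1
  · obtain ⟨s, rfl⟩ := HypersurfaceRing.algebraMap_surjective _ r
    rw [← map_mul, HypersurfaceRing.algebraMap_eq_zero_iff] at hr
    obtain ⟨u, hu⟩ := hr
    have h1 := congrArg (atZero ι) hu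
    rw [map_mul, map_mul, hX, zero_mul, eq_comm] at h1
    obtain ⟨w, rfl⟩ := (h0.eq_zero_iff u).1 ((mul_eq_zero.1 h1).resolve_left hf)
    rw [HypersurfaceRing.algebraMap_eq_zero_iff]
    refine ⟨w, mul_left_cancel₀ (ConvPS.X_ne_zero (Sum.inr ())) ?_⟩
    rw [hu]
    ring

lemma parameterInclusion_X (ι : Type*) :
    parameterInclusion ι (ConvPS.X ()) = ConvPS.X (Sum.inr ()) :=
  ConvPS.toFormal_injective (MvPowerSeries.rename_X _ _)

lemma algebraMap_parameter {ι : Type*} (F : ConvPS (ι ⊕ Unit)) (c : ConvPS Unit) :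
    algebraMap (ConvPS Unit) (HypersurfaceRing F) c =
      algebraMap (ConvPS (ι ⊕ Unit)) (HypersurfaceRing F) (parameterInclusion ι c) := rfl

lemma ConvPS.constantCoeff_algebraMap {σ : Type*} (c : ℂ) :
    (algebraMap ℂ (ConvPS σ) c).constantCoeff = c :=
  MvPowerSeries.constantCoeff_C c

lemma ConvPS.constantCoeff_parameterInclusion {ι : Type*} (c : ConvPS Unit) :
    (parameterInclusion ι c).constantCoeff = c.constantCoeff :=
  MvPowerSeries.constantCoeff_rename _ _

lemma ConvPS.constantCoeff_atZero {ι : Type*} (F : ConvPS (ι ⊕ Unit)) :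
    (atZero ι F).constantCoeff = F.constantCoeff := by
  rw [← ConvPS.coeff_zero, ← ConvPS.coeff_zero]
  change MvPowerSeries.coeff 0 (MvPowerSeries.killCompl _ (ConvPS.toFormal _ F)) = _
  rw [MvPowerSeries.coeff_killCompl, Finsupp.embDomain_zero]

section Parameter

variable {ι : Type*} [Finite ι] {F : ConvPS (ι ⊕ Unit)}

lemma HypersurfaceRing.algebraMap_mem_maximalIdeal [IsLocalRing (HypersurfaceRing F)]
    {s : ConvPS (ι ⊕ Unit)} (hs : s ∈ IsLocalRing.maximalIdeal _) :
    algebraMap _ (HypersurfaceRing F) s ∈ IsLocalRing.maximalIdeal (HypersurfaceRing F) :=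
  have := IsLocalHom.of_surjective _ (HypersurfaceRing.algebraMap_surjective F)
  fun h => hs (isUnit_of_map_unit _ _ h)

/-- The length of a module over `ℂ{x, t} / (F)` is its length over `ℂ{t}`. -/
lemma length_parameter (hF : F.constantCoeff = 0) (T : Type*) [AddCommGroup T]
    [Module (ConvPS Unit) T] [Module (HypersurfaceRing F) T]
    [IsScalarTower (ConvPS Unit) (HypersurfaceRing F) T] :
    Module.length (ConvPS Unit) T = Module.length (HypersurfaceRing F) T := by
  have := HypersurfaceRing.isLocalRing hF
  have : IsLocalHom (algebraMap (ConvPS Unit) (HypersurfaceRing F)) := by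
    refine ⟨fun c hc => ?_⟩
    by_contra h
    rw [ConvPS.isUnit_iff, not_not] at h
    rw [algebraMap_parameter] at hc
    refine HypersurfaceRing.algebraMap_mem_maximalIdeal (F := F) (s := parameterInclusion ι c) ?_ hc
    rw [ConvPS.mem_maximalIdeal_iff, ConvPS.constantCoeff_parameterInclusion, h]
  refine length_restrictScalars_eq T fun r => ?_
  obtain ⟨s, rfl⟩ := HypersurfaceRing.algebraMap_surjective _ r
  -- Both residue fields are `ℂ`: an element agrees with its constant term modulo the maximal ideal.
  refine ⟨algebraMap ℂ _ s.constantCoeff, ?_⟩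
  rw [algebraMap_parameter, ← map_sub]
  refine HypersurfaceRing.algebraMap_mem_maximalIdeal ?_
  rw [ConvPS.mem_maximalIdeal_iff, ← ConvPS.constantCoeffHom_apply, map_sub, AlgHom.commutes,
    ConvPS.constantCoeffHom_apply, ConvPS.constantCoeffHom_apply, ConvPS.constantCoeff_algebraMap,
    sub_self]

lemma finite_parameter (T : Type*) [AddCommGroup T]
    [Module (ConvPS Unit) T] [Module (HypersurfaceRing F) T]
    [IsScalarTower (ConvPS Unit) (HypersurfaceRing F) T] [Module.Finite (HypersurfaceRing F) T]
    (h : Module.length (HypersurfaceRing F) (SMulCoker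
      (algebraMap (ConvPS Unit) (HypersurfaceRing F) (ConvPS.X ())) T) ≠ ⊤) :
    Module.Finite (ConvPS Unit) T := by
  let : Module (ConvPS (ι ⊕ Unit)) T := Module.compHom T (algebraMap _ (HypersurfaceRing F))
  have : IsScalarTower (ConvPS (ι ⊕ Unit)) (HypersurfaceRing F) T := IsScalarTower.of_compHom _ _ _
  have hsurj := HypersurfaceRing.algebraMap_surjective F
  have : Module.Finite (ConvPS (ι ⊕ Unit)) (HypersurfaceRing F) :=
    Module.Finite.of_surjective (Algebra.linearMap _ _) hsurj
  have : Module.Finite (ConvPS (ι ⊕ Unit)) T := Module.Finite.trans (HypersurfaceRing F) T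
  refine ConvPS.finite_of_length_smulCoker_ne_top (ι := ι) (fun c m => ?_) ?_
  · rw [← algebraMap_smul (HypersurfaceRing F) c, algebraMap_parameter, algebraMap_smul]
  · rwa [length_smulCoker_algebraMap (R := HypersurfaceRing F),
      length_eq_of_surjective_algebraMap _ hsurj, ← parameterInclusion_X]

end Parameter

/-! ### Assembling the proof -/

/-- An `R`-linear isomorphism from `Tor`, as an isomorphism over a base ring `A`. -/
def torModuleOverEquiv {A R : Type u} [CommRing A] [CommRing R] [Algebra A R] {M N : Type u}
    [AddCommGroup M] [Module R M] [AddCommGroup N] [Module R N] {i : ℕ} {H : Type u}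
    [AddCommGroup H] [Module R H] [Module A H] [IsScalarTower A R H]
    (e : torModule R M N i ≃ₗ[R] H) : torModuleOver A R M N i ≃ₗ[A] H where
  toFun := e
  invFun := e.symm
  left_inv := e.left_inv
  right_inv := e.right_inv
  map_add' := e.map_add
  map_smul' c x := (e.map_smul (algebraMap A R c) x).trans (algebraMap_smul R c _)

section Eventually

variable {R : Type u} [CommRing R] {N : Type u} [AddCommGroup N] [Module R N] {l m : ℕ}
  {A B : Matrix (Fin m) (Fin m) R}

lemma IsTorTail.eventually (h : IsTorTail N (2 * l) A B) (M : Type u) [AddCommGroup M]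
    [Module R M] : (∀ᶠ k : ℕ in atTop,
      Nonempty (torModule R M N (2 * k) ≃ₗ[R] MatHomology M B A)) ∧
    ∀ᶠ k : ℕ in atTop, Nonempty (torModule R M N (2 * k + 1) ≃ₗ[R] MatHomology M A B) := by
  constructor
  · filter_upwards [eventually_ge_atTop (l + 1)] with k hk
    have := (h M (k - l - 1)).2
    rwa [show 2 * l + 2 * (k - l - 1) + 2 = 2 * k by lia] at this
  · filter_upwards [eventually_ge_atTop l] with k hk
    have := (h M (k - l)).1
    rwa [show 2 * l + 2 * (k - l) + 1 = 2 * k + 1 by lia] at this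

end Eventually

/-- The Tor tail of `N` and of its special fibre are computed by one matrix factorization of `F`,
with an even shift. -/
theorem exists_isTorTail_even (n : ℕ) {F : ConvPS (Fin n ⊕ Unit)} (hf : atZero (Fin n) F ≠ 0)
    (N : Type) [AddCommGroup N] [Module (HypersurfaceRing F) N]
    [Module.Finite (HypersurfaceRing F) N] {N' : Type} [AddCommGroup N']
    [Module (HypersurfaceRing (atZero (Fin n) F)) N'] {q : N →ₛₗ[toSpecialFibre F] N'}
    (hq : IsModuleFibre (algebraMap (ConvPS (Fin n ⊕ Unit)) (HypersurfaceRing F)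
      (ConvPS.X (Sum.inr ()))) q) :
    ∃ (l m : ℕ) (A B : Matrix (Fin m) (Fin m) (ConvPS (Fin n ⊕ Unit))),
      A * B = Matrix.scalar (Fin m) F ∧ B * A = Matrix.scalar (Fin m) F ∧
      IsTorTail N (2 * l) (A.map (algebraMap _ (HypersurfaceRing F)))
        (B.map (algebraMap _ (HypersurfaceRing F))) ∧
      IsTorTail N' (2 * l) ((A.map (algebraMap _ (HypersurfaceRing F))).map (toSpecialFibre F))
        ((B.map (algebraMap _ (HypersurfaceRing F))).map (toSpecialFibre F)) := by
  let : Module (ConvPS (Fin n ⊕ Unit)) N := Module.compHom N (algebraMap _ (HypersurfaceRing F))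
  have : IsScalarTower (ConvPS (Fin n ⊕ Unit)) (HypersurfaceRing F) N :=
    IsScalarTower.of_compHom _ _ _
  have hsurj := HypersurfaceRing.algebraMap_surjective F
  have : Module.Finite (ConvPS (Fin n ⊕ Unit)) (HypersurfaceRing F) :=
    Module.Finite.of_surjective (Algebra.linearMap _ _) hsurj
  have : Module.Finite (ConvPS (Fin n ⊕ Unit)) N := Module.Finite.trans (HypersurfaceRing F) N
  obtain ⟨d, hd⟩ := ConvPS.exists_hasProjectiveDimensionLT_sum n
  have hdN := hd N
  obtain ⟨k, m, A, B, hAB, hBA, h1, h2⟩ := exists_isTorTail (ψ := (atZero (Fin n)).toRingHom)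
    (φ := toSpecialFibre F) (F := F) rfl hf hsurj (HypersurfaceRing.algebraMap_eq_zero_iff F)
    (HypersurfaceRing.algebraMap_surjective _) (HypersurfaceRing.algebraMap_eq_zero_iff _)
    (isRingFibre_toSpecialFibre hf) d hq (hasProjectiveDimensionLT_of_ge _ (d + 1) _ (by lia))
  rcases Nat.even_or_odd' k with ⟨l, rfl | rfl⟩
  · exact ⟨l, m, A, B, hAB, hBA, h1, h2⟩
  -- An odd start is moved up by one degree, which exchanges `A` and `B`.
  · exact ⟨l + 1, m, B, A, hBA, hAB, h1.succ, h2.succ⟩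

end

theorem corollary6p1 (n : ℕ) (F : ConvPS (Fin (n + 1) ⊕ Unit))
    -- `f = F(x, 0)` is a nonzero power series with `f(0) = 0`
    (hf : atZero (Fin (n + 1)) F ≠ 0)
    (hf0 : (atZero (Fin (n + 1)) F).constantCoeff = 0)
    (M N : Type)
    [AddCommGroup M] [Module (HypersurfaceRing F) M] [Module.Finite (HypersurfaceRing F) M]
    [Module (ConvPS Unit) M] [IsScalarTower (ConvPS Unit) (HypersurfaceRing F) M]
    [Module.Flat (ConvPS Unit) M]
    [AddCommGroup N] [Module (HypersurfaceRing F) N] [Module.Finite (HypersurfaceRing F) N]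
    [Module (ConvPS Unit) N] [IsScalarTower (ConvPS Unit) (HypersurfaceRing F) N]
    [Module.Flat (ConvPS Unit) N]
    (hfin : IsIsolatedSingularity (atZero (Fin (n + 1)) F) ∨
      ∀ᶠ i : ℕ in atTop, Module.length (HypersurfaceRing (atZero (Fin (n + 1)) F))
        (torModule (HypersurfaceRing (atZero (Fin (n + 1)) F))
          (SpecialFibre F M) (SpecialFibre F N) i) ≠ ⊤) :
    ∃ p q : ℕ,
      (∀ᶠ k : ℕ in atTop,
        Module.Finite (ConvPS Unit)
          (torModuleOver (ConvPS Unit) (HypersurfaceRing F) M N (2 * k)) ∧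
        Module.finrank (ConvPS Unit)
          (torModuleOver (ConvPS Unit) (HypersurfaceRing F) M N (2 * k)) = p) ∧
      (∀ᶠ k : ℕ in atTop,
        Module.Finite (ConvPS Unit)
          (torModuleOver (ConvPS Unit) (HypersurfaceRing F) M N (2 * k + 1)) ∧
        Module.finrank (ConvPS Unit)
          (torModuleOver (ConvPS Unit) (HypersurfaceRing F) M N (2 * k + 1)) = q) ∧
      HasTheta (HypersurfaceRing (atZero (Fin (n + 1)) F)) (SpecialFibre F M) (SpecialFibre F N)
        ((p : ℤ) - (q : ℤ)) := by
  have hX : algebraMap (ConvPS Unit) (HypersurfaceRing F) (ConvPS.X ()) =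
      algebraMap (ConvPS (Fin (n + 1) ⊕ Unit)) (HypersurfaceRing F) (ConvPS.X (Sum.inr ())) := by
    rw [algebraMap_parameter, parameterInclusion_X]
  have hφ := isRingFibre_toSpecialFibre hf
  -- Flatness over `ℂ{t}` makes the nonzero element `t` act injectively.
  have hregular (P : Type) [AddCommGroup P] [Module (HypersurfaceRing F) P]
      [Module (ConvPS Unit) P] [IsScalarTower (ConvPS Unit) (HypersurfaceRing F) P]
      [Module.Flat (ConvPS Unit) P] (m : P) (hm : algebraMap (ConvPS (Fin (n + 1) ⊕ Unit))
        (HypersurfaceRing F) (ConvPS.X (Sum.inr ())) • m = 0) : m = 0 := by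
    rw [← hX, algebraMap_smul] at hm
    exact (Module.Flat.isSMulRegular_of_isRegular
      (IsRegular.of_ne_zero (ConvPS.X_ne_zero ()))).right_eq_zero_of_smul hm
  have hqM := isModuleFibre_tensorFibreMap (R' := HypersurfaceRing (atZero (Fin (n + 1)) F))
    hφ M (hregular M)
  have hqN := isModuleFibre_tensorFibreMap (R' := HypersurfaceRing (atZero (Fin (n + 1)) F))
    hφ N (hregular N)
  obtain ⟨l, m, A, B, hAB, hBA, hT, hT'⟩ := exists_isTorTail_even (n + 1) hf N hqN
  have hF : F.constantCoeff = 0 := by rwa [← ConvPS.constantCoeff_atZero]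
  set α := algebraMap (ConvPS (Fin (n + 1) ⊕ Unit)) (HypersurfaceRing F)
  obtain ⟨hev, hodd⟩ := hT.eventually M
  obtain ⟨hev', hodd'⟩ := hT'.eventually (SpecialFibre F M)
  have hzero {C D : Matrix (Fin m) (Fin m) (ConvPS (Fin (n + 1) ⊕ Unit))}
      (h : C * D = Matrix.scalar (Fin m) F) : C.map α * D.map α = 0 := by
    rw [← Matrix.map_mul, h]
    ext i j
    by_cases hij : i = j
    · subst hij
      simpa [α] using (HypersurfaceRing.algebraMap_eq_zero_iff F F).2 dvd_rfl
    · simp [Matrix.diagonal_apply_ne _ hij]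
  have hfibre {C D : Matrix (Fin m) (Fin m) (ConvPS (Fin (n + 1) ⊕ Unit))}
      (h : C * D = Matrix.scalar (Fin m) F) : C.map (atZero (Fin (n + 1))) *
        D.map (atZero (Fin (n + 1))) = Matrix.scalar (Fin m) (atZero (Fin (n + 1)) F) := by
    rw [← Matrix.map_mul, h]
    ext i j
    by_cases hij : i = j
    · subst hij; simp
    · simp [Matrix.diagonal_apply_ne _ hij]
  have hlen : Module.length (HypersurfaceRing (atZero (Fin (n + 1)) F))
        (MatHomology (SpecialFibre F M) ((A.map α).map (toSpecialFibre F))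
          ((B.map α).map (toSpecialFibre F))) ≠ ⊤ ∧
      Module.length (HypersurfaceRing (atZero (Fin (n + 1)) F))
        (MatHomology (SpecialFibre F M) ((B.map α).map (toSpecialFibre F))
          ((A.map α).map (toSpecialFibre F))) ≠ ⊤ := by
    -- In the isolated case the derivatives of `f` bound the homology. Otherwise one large degree of
    -- each parity suffices, since the tail is two-periodic.
    rcases hfin with h | h
    · exact ⟨HypersurfaceRing.length_matHomology_ne_top h (hfibre hBA) _,
        HypersurfaceRing.length_matHomology_ne_top h (hfibre hAB) _⟩
    · have htend : Tendsto (fun k : ℕ => 2 * k) atTop atTop :=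
        tendsto_id.const_mul_atTop' (by norm_num)
      have htend' : Tendsto (fun k : ℕ => 2 * k + 1) atTop atTop :=
        tendsto_atTop_mono (fun k => (2 * k).le_succ) htend
      obtain ⟨k, hk, ⟨e⟩⟩ := ((htend.eventually h).and hev').exists
      obtain ⟨k', hk', ⟨e'⟩⟩ := ((htend'.eventually h).and hodd').exists
      rw [← e.length_eq, ← e'.length_eq]
      exact ⟨hk', hk⟩
  obtain ⟨hfinA, hfinB, hcount⟩ := length_add_finrank_matHomology ConvPS.irreducible_X_unit
    (hX ▸ hφ) (hX ▸ hqM) (fun T _ _ _ _ => length_parameter hF T)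
    (fun T _ _ _ _ _ => finite_parameter T) (hzero hAB) (hzero hBA) hlen.1 hlen.2
  refine ⟨Module.finrank (ConvPS Unit) (MatHomology M (B.map α) (A.map α)),
    Module.finrank (ConvPS Unit) (MatHomology M (A.map α) (B.map α)), ?_, ?_, ?_⟩
  · filter_upwards [hev] with k ⟨e⟩
    exact ⟨Module.Finite.equiv (torModuleOverEquiv e).symm, (torModuleOverEquiv e).finrank_eq⟩
  · filter_upwards [hodd] with k ⟨e⟩
    exact ⟨Module.Finite.equiv (torModuleOverEquiv e).symm, (torModuleOverEquiv e).finrank_eq⟩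
  · obtain ⟨a, ha⟩ := ENat.ne_top_iff_exists.1 hlen.1
    obtain ⟨b, hb⟩ := ENat.ne_top_iff_exists.1 hlen.2
    -- Even degrees carry `H(B, A)` and odd ones `H(A, B)`, hence the order `b`, `a`.
    refine ⟨b, a, ?_, ?_, ?_⟩
    · filter_upwards [hev'] with k ⟨e⟩
      rw [e.length_eq, ← hb]
    · filter_upwards [hodd'] with k ⟨e⟩
      rw [e.length_eq, ← ha]
    · rw [← ha, ← hb] at hcount
      have : a + Module.finrank (ConvPS Unit) (MatHomology M (B.map α) (A.map α)) =
          b + Module.finrank (ConvPS Unit) (MatHomology M (A.map α) (B.map α)) := by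
        exact_mod_cast hcount
      lia
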